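/- Let $M$ be a paracompact Hausdorff topological space, for example a manifold, and let $\lambda$ be a complex (respectively hermitian) line bundle over $M$. Write $H^2(M,A)$ for Čech cohomology with coefficients in the constant sheaf of the discrete abelian group $A$, i.e. the direct limit over all open covers. Let $\sqrt\lambda$ be the $\mathbb Z_2$ gerbe of local square roots of $\lambda$. Over an open set $U\subseteq M$ its objects are the pairs $(\tau,\iota)$ of a complex (respectively hermitian) line bundle $\tau$ over $U$ and a (respectively isometric) bundle isomorphism $\iota:\tau\otimes\tau\to\lambda|_U$. A morphism $(\tau,\iota)\to(\tau',\iota')$ is a (respectively isometric) bundle isomorphism $\sigma:\tau\to\tau'$ with $\iota'\circ(\sigma\otimes\sigma)=\iota$. The automorphisms of an object over $U$ are the multiplications by $(-1)^a$ with $a:U\to\mathbb Z_2$ locally constant. The Giraud class $\gamma(\sqrt\lambda)\in H^2(M,\mathbb Z_2)$ is defined as follows. Choose an open cover $(U_i)$ of $M$, objects $O_i$ of $\sqrt\lambda$ over $U_i$ and isomorphisms $\sigma_{ij}:O_j\to O_i$ over $U_i\cap U_j$ (such choices exist for a suitable cover). The automorphisms $\sigma_{ij}\sigma_{jk}\sigma_{ik}^{-1}=(-1)^{\gamma_{ijk}}$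 of $O_i$ over $U_i\cap U_j\cap U_k$ give a Čech 2-cocycle $(\gamma_{ijk})$ with values in $\mathbb Z_2$, and $\gamma(\sqrt\lambda)$ is its class. The Chern class $c(\lambda)\in H^2(M,\mathbb Z)$ is defined as follows. Choose an open cover $(U_i)$, (respectively isometric) trivializations $\epsilon_i$ of $\lambda$ over $U_i$, and continuous complex-valued (respectively real-valued) functions $\theta_{ij}$ on $U_i\cap U_j$ such that $\epsilon_i\epsilon_j^{-1}$ is multiplication by $e^{2\pi i\theta_{ij}}$ (again, these exist for a suitable cover). The integers $c_{ijk}=\theta_{ij}+\theta_{jk}-\theta_{ik}$ form a Čech 2-cocycle, and $c(\lambda)$ is its class. Then both classes are well defined, i.e. they exist and do not depend on the choices, and $\gamma(\sqrt\lambda)$ is the image of $c(\lambda)$ under the reduction homomorphism $H^2(M,\mathbb Z)\to H^2(M,\mathbb Z_2)$. -/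

import Mathlib

open CategoryTheory Opposite TopologicalSpace Bundle
open scoped TensorProduct

universe u v

noncomputable section

namespace SqrtGerbe

/-! ### Čech cohomology in degree two with coefficients in a constant sheaf -/

section Cech

variable {M : Type u} [TopologicalSpace M]

/-- An open cover of `M` indexed by the points of `M`, the set with index `x` being a
neighbourhood of `x`. Every open cover `(Vᵢ)` is refined by one of these: put `U x = Vᵢ` for some
`i` with `x ∈ Vᵢ`. Refinement is then the pointwise order, so that Čech cohomology is a direct
limit over a directed preorder. -/
structure PointedCover (M : Type u) [TopologicalSpace M] where
  set : M → Opens M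
  mem : ∀ x, x ∈ set x

namespace PointedCover

/-- `U ≤ V` means that `V` is a refinement of `U`. -/
instance : Preorder (PointedCover M) where
  le U V := ∀ x, V.set x ≤ U.set x
  le_refl _ _ := le_rfl
  le_trans _ _ _ h h' x := (h' x).trans (h x)

instance : Nonempty (PointedCover M) := ⟨⟨fun _ => ⊤, fun _ => trivial⟩⟩

instance : IsDirectedOrder (PointedCover M) where
  directed U V := ⟨⟨fun x => U.set x ⊓ V.set x, fun x => ⟨U.mem x, V.mem x⟩⟩,
    fun _ => inf_le_left, fun _ => inf_le_right⟩

/-- Double, triple and quadruple intersections of members of a cover. -/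
abbrev inter₂ (U : PointedCover M) (x y : M) : Opens M := U.set x ⊓ U.set y

abbrev inter₃ (U : PointedCover M) (x y z : M) : Opens M := U.set x ⊓ U.set y ⊓ U.set z

abbrev inter₄ (U : PointedCover M) (x y z w : M) : Opens M :=
  U.set x ⊓ U.set y ⊓ U.set z ⊓ U.set w

end PointedCover

/-- The inclusion of an open set in a larger one, as a continuous map. -/
def incl {V W : Opens M} (h : V ≤ W) : C(V, W) := ⟨Set.inclusion h, continuous_inclusion h⟩

variable (A : Type) [AddCommGroup A] (B : Type) [AddCommGroup B]

/-- Restriction of sections of the constant sheaf `A`, i.e. of locally constant functions. -/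
def resLC {V W : Opens M} (h : V ≤ W) : LocallyConstant W A →+ LocallyConstant V A :=
  LocallyConstant.comapAddMonoidHom (incl h)

/-- Čech cochains of a cover in degrees 1, 2, 3 with coefficients in the constant sheaf `A`. -/
abbrev C₁ (U : PointedCover M) : Type u := ∀ x y : M, LocallyConstant (U.inter₂ x y) A

abbrev C₂ (U : PointedCover M) : Type u := ∀ x y z : M, LocallyConstant (U.inter₃ x y z) A

abbrev C₃ (U : PointedCover M) : Type u := ∀ x y z w : M, LocallyConstant (U.inter₄ x y z w) A

/-- `(δb)_{xyz} = b_{yz} - b_{xz} + b_{xy}` on the triple intersections. -/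
def δ₁ (U : PointedCover M) : C₁ A U →+ C₂ A U where
  toFun b x y z :=
    resLC A (W := U.inter₂ y z) (le_inf (inf_le_left.trans inf_le_right) inf_le_right) (b y z)
    - resLC A (W := U.inter₂ x z) (le_inf (inf_le_left.trans inf_le_left) inf_le_right) (b x z)
    + resLC A (W := U.inter₂ x y) inf_le_left (b x y)
  map_zero' := by ext; simp
  map_add' b b' := by
    simp only [Pi.add_apply, map_add]
    ext
    simp only [LocallyConstant.coe_add, LocallyConstant.coe_sub, Pi.add_apply, Pi.sub_apply]
    abel

/-- `(δc)_{xyzw} = c_{yzw} - c_{xzw} + c_{xyw} - c_{xyz}` on the quadruple intersections. -/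
def δ₂ (U : PointedCover M) : C₂ A U →+ C₃ A U where
  toFun c x y z w :=
    resLC A (W := U.inter₃ y z w) 
      (le_inf (le_inf (inf_le_left.trans (inf_le_left.trans inf_le_right))
        (inf_le_left.trans inf_le_right)) inf_le_right) (c y z w)
    - resLC A (W := U.inter₃ x z w) 
      (le_inf (le_inf (inf_le_left.trans (inf_le_left.trans inf_le_left))
        (inf_le_left.trans inf_le_right)) inf_le_right) (c x z w)
    + resLC A (W := U.inter₃ x y w) (le_inf (inf_le_left.trans inf_le_left) inf_le_right) (c x y w)
    - resLC A (W := U.inter₃ x y z) inf_le_left (c x y z)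
  map_zero' := by ext; simp
  map_add' b b' := by
    simp only [Pi.add_apply, map_add]
    ext
    simp only [LocallyConstant.coe_add, LocallyConstant.coe_sub, Pi.add_apply, Pi.sub_apply]
    abel

/-- Čech 2-cocycles of a cover. -/
abbrev Z₂ (U : PointedCover M) : AddSubgroup (C₂ A U) := (δ₂ A U).ker

/-- Every coboundary is a cocycle. -/
theorem δ₁_mem (U : PointedCover M) (b : C₁ A U) : δ₁ A U b ∈ Z₂ A U := by
  ext x y z w p
  change (b z w ⟨p, _⟩ - b y w ⟨p, _⟩ + b y z ⟨p, _⟩)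
    - (b z w ⟨p, _⟩ - b x w ⟨p, _⟩ + b x z ⟨p, _⟩)
    + (b y w ⟨p, _⟩ - b x w ⟨p, _⟩ + b x y ⟨p, _⟩)
    - (b y z ⟨p, _⟩ - b x z ⟨p, _⟩ + b x y ⟨p, _⟩) = 0
  abel

/-- The second Čech cohomology group of a cover. -/
abbrev HCover (U : PointedCover M) : Type u := Z₂ A U ⧸ (δ₁ A U).range.addSubgroupOf (Z₂ A U)

/-- Restriction of 2-cochains to a finer cover. -/
def refineC₂ {U V : PointedCover M} (h : U ≤ V) : C₂ A U →+ C₂ A V where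
  toFun c x y z := resLC A (W := U.inter₃ x y z)
    (inf_le_inf (inf_le_inf (h x) (h y)) (h z)) (c x y z)
  map_zero' := by ext; simp
  map_add' _ _ := by ext; simp

/-- Restriction of 2-cocycles to a finer cover. -/
def refineZ₂ {U V : PointedCover M} (h : U ≤ V) : Z₂ A U →+ Z₂ A V :=
  ((refineC₂ A h).comp (Z₂ A U).subtype).codRestrict (Z₂ A V) (by
    rintro ⟨c, hc⟩
    ext x y z w p
    have := DFunLike.congr_fun (congrFun (congrFun (congrFun (congrFun hc x) y) z) w)
      (incl (inf_le_inf (inf_le_inf (inf_le_inf (h x) (h y)) (h z)) (h w)) p)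
    exact this)

/-- Restriction of cohomology classes to a finer cover. -/
def refineH {U V : PointedCover M} (h : U ≤ V) : HCover A U →+ HCover A V :=
  QuotientAddGroup.map _ _ (refineZ₂ A h) (by
    rintro ⟨c, hc⟩ ⟨b, hb⟩
    refine ⟨fun x y => resLC A (W := U.inter₂ x y) (inf_le_inf (h x) (h y)) (b x y), ?_⟩
    ext x y z p
    have := DFunLike.congr_fun (congrFun (congrFun (congrFun hb x) y) z)
      (incl (inf_le_inf (inf_le_inf (h x) (h y)) (h z)) p)
    exact this)

variable (M) in
open Classical in
/-- The Čech cohomology group `H²(M, A)`: the direct limit over all open covers. -/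
abbrev H2 : Type u :=
  AddCommGroup.DirectLimit (fun U : PointedCover M => HCover A U) (fun _ _ h => refineH A h)

open Classical in
/-- The class in `H²(M, A)` of a Čech 2-cocycle of a cover. -/
def cls (U : PointedCover M) : Z₂ A U →+ H2 M A :=
  (AddCommGroup.DirectLimit.of (fun U : PointedCover M => HCover A U)
    (fun _ _ h => refineH A h) U).comp (QuotientAddGroup.mk' _)

variable {A B}

/-- Change of coefficients on cocycles. -/
def coeffZ₂ (φ : A →+ B) (U : PointedCover M) : Z₂ A U →+ Z₂ B U where
  toFun c := ⟨fun x y z => (c.1 x y z).map φ, by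
    obtain ⟨c, hc⟩ := c
    ext x y z w p
    have := congrArg φ
      (DFunLike.congr_fun (congrFun (congrFun (congrFun (congrFun hc x) y) z) w) p)
    change φ (c y z w _ - c x z w _ + c x y w _ - c x y z _) = φ 0 at this
    rw [map_sub, map_add, map_sub, map_zero] at this
    exact this⟩
  map_zero' := by ext; simp
  map_add' _ _ := by ext; simp

/-- Change of coefficients on the cohomology of a cover. -/
def coeffH (φ : A →+ B) (U : PointedCover M) : HCover A U →+ HCover B U :=
  QuotientAddGroup.map _ _ (coeffZ₂ φ U) (by
    rintro ⟨c, hc⟩ ⟨b, hb⟩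
    refine ⟨fun x y => (b x y).map φ, ?_⟩
    ext x y z p
    have := congrArg φ
      (DFunLike.congr_fun (congrFun (congrFun (congrFun hb x) y) z) p)
    change φ (b y z _ - b x z _ + b x y _) = _ at this
    rw [map_add, map_sub] at this
    exact this)

variable (M) in
open Classical in
/-- The map `H²(M, A) → H²(M, B)` induced by a homomorphism `A → B` of coefficient groups. -/
def H2.map (φ : A →+ B) : H2 M A →+ H2 M B :=
  AddCommGroup.DirectLimit.map (fun U => coeffH φ U) (by
    intro U V h
    ext c
    rfl)

variable (M) in
/-- Reduction modulo two. -/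
def mod2 : H2 M ℤ →+ H2 M (ZMod 2) := H2.map M (Int.castAddHom (ZMod 2))

end Cech

/-! ### Complex and hermitian line bundles -/

section LineBundle

/-- A (topological, locally trivial) complex line bundle over `X`. -/
structure LineBundle (X : Type u) [TopologicalSpace X] where
  fiber : X → Type v
  [addCommGroup : ∀ x, AddCommGroup (fiber x)]
  [module : ∀ x, Module ℂ (fiber x)]
  [topTotal : TopologicalSpace (TotalSpace ℂ fiber)]
  [topFiber : ∀ x, TopologicalSpace (fiber x)]
  [fiberBundle : FiberBundle ℂ fiber]
  [vectorBundle : VectorBundle ℂ ℂ fiber]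

attribute [instance] LineBundle.addCommGroup LineBundle.module LineBundle.topTotal
  LineBundle.topFiber LineBundle.fiberBundle LineBundle.vectorBundle

variable {X : Type u} [TopologicalSpace X] {Y : Type u} [TopologicalSpace Y]

namespace LineBundle

/-- The total space. -/
abbrev Total (E : LineBundle.{u, v} X) : Type (max u v) := TotalSpace ℂ E.fiber

/-- The fibre product `E ×_X E`. -/
abbrev Total₂ (E : LineBundle.{u, v} X) : Type (max u v) :=
  TotalSpace (ℂ × ℂ) (E.fiber ×ᵇ E.fiber)

/-- Pullback of a line bundle; for an inclusion of open sets this is the restriction. -/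
def pullback (E : LineBundle.{u, v} X) (f : C(Y, X)) : LineBundle.{u, v} Y where
  fiber := (f : Y → X) *ᵖ E.fiber
  addCommGroup y := inferInstanceAs (AddCommGroup (E.fiber (f y)))
  module y := inferInstanceAs (Module ℂ (E.fiber (f y)))
  fiberBundle := FiberBundle.pullback f
  vectorBundle := VectorBundle.pullback ℂ f

/-- An isomorphism of line bundles over `X`. -/
@[ext]
structure Iso (E E' : LineBundle.{u, v} X) where
  equiv : ∀ x, E.fiber x ≃ₗ[ℂ] E'.fiber x
  continuous_equiv : Continuous fun p : E.Total => (⟨p.1, equiv p.1 p.2⟩ : E'.Total)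
  continuous_symm : Continuous fun p : E'.Total => (⟨p.1, (equiv p.1).symm p.2⟩ : E.Total)

namespace Iso

def refl (E : LineBundle.{u, v} X) : Iso E E where
  equiv _ := LinearEquiv.refl ℂ _
  continuous_equiv := continuous_id
  continuous_symm := continuous_id

def symm {E E' : LineBundle.{u, v} X} (σ : Iso E E') : Iso E' E where
  equiv x := (σ.equiv x).symm
  continuous_equiv := σ.continuous_symm
  continuous_symm := σ.continuous_equiv

def trans {E E' E'' : LineBundle.{u, v} X} (σ : Iso E E') (τ : Iso E' E'') : Iso E E'' where
  equiv x := (σ.equiv x).trans (τ.equiv x)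
  continuous_equiv := τ.continuous_equiv.comp σ.continuous_equiv
  continuous_symm := σ.continuous_symm.comp τ.continuous_symm

end Iso

theorem continuous_to_pullback {T : Type*} [TopologicalSpace T] (E : LineBundle.{u, v} X)
    (f : C(Y, X)) {g : T → (E.pullback f).Total} (h₁ : Continuous fun t => (g t).1)
    (h₂ : Continuous fun t => (⟨f (g t).1, (g t).2⟩ : E.Total)) : Continuous g :=
  (inducing_pullbackTotalSpaceEmbedding ℂ E.fiber f).continuous_iff.2 (h₁.prodMk h₂)

theorem continuous_lift (E : LineBundle.{u, v} X) (f : C(Y, X)) :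
    Continuous fun p : (E.pullback f).Total => (⟨f p.1, p.2⟩ : E.Total) :=
  Pullback.continuous_lift ℂ E.fiber f

theorem continuous_lift₂ (E : LineBundle.{u, v} X) (f : C(Y, X)) :
    Continuous fun p : (E.pullback f).Total₂ => (⟨f p.1, p.2⟩ : E.Total₂) := by
  refine (FiberBundle.Prod.isInducing_diag ℂ E.fiber ℂ E.fiber).continuous_iff.2 ?_
  have h := (FiberBundle.Prod.isInducing_diag ℂ (E.pullback f).fiber ℂ
    (E.pullback f).fiber).continuous
  exact ((E.continuous_lift f).comp (continuous_fst.comp h)).prodMk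
    ((E.continuous_lift f).comp (continuous_snd.comp h))

/-- Pullback of an isomorphism. -/
def Iso.pullback {E E' : LineBundle.{u, v} X} (σ : Iso E E') (f : C(Y, X)) :
    Iso (E.pullback f) (E'.pullback f) where
  equiv y := σ.equiv (f y)
  continuous_equiv := E'.continuous_to_pullback f
    (FiberBundle.continuous_proj ℂ (E.pullback f).fiber)
    (σ.continuous_equiv.comp (E.continuous_lift f))
  continuous_symm := E.continuous_to_pullback f
    (FiberBundle.continuous_proj ℂ (E'.pullback f).fiber)
    (σ.continuous_symm.comp (E'.continuous_lift f))

end LineBundle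

/-- The canonical identifications `E|_U ≃ E` and `E|_W ≃ (E|_V)|_W`. -/
def LineBundle.pullbackId {M : Type u} [TopologicalSpace M] {U : Opens M}
    (E : LineBundle.{u, v} U) : LineBundle.Iso (E.pullback (incl le_rfl)) E where
  equiv x := (LinearEquiv.refl ℂ (E.fiber x) : (E.pullback (incl le_rfl)).fiber x ≃ₗ[ℂ] E.fiber x)
  continuous_equiv := E.continuous_lift (incl le_rfl)
  continuous_symm := E.continuous_to_pullback (incl le_rfl)
    (FiberBundle.continuous_proj ℂ E.fiber) continuous_id

def LineBundle.pullbackComp {M : Type u} [TopologicalSpace M] {U V W : Opens M}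
    (E : LineBundle.{u, v} U) (h : V ≤ U) (h' : W ≤ V) :
    LineBundle.Iso (E.pullback (incl (h'.trans h))) ((E.pullback (incl h)).pullback (incl h')) where
  equiv x := (LinearEquiv.refl ℂ (E.fiber (incl (h'.trans h) x)) :
    (E.pullback (incl (h'.trans h))).fiber x ≃ₗ[ℂ] ((E.pullback (incl h)).pullback (incl h')).fiber x)
  continuous_equiv := (E.pullback (incl h)).continuous_to_pullback (incl h')
    (FiberBundle.continuous_proj ℂ (E.pullback (incl (h'.trans h))).fiber)
    (E.continuous_to_pullback (incl h)
      ((incl h').continuous.comp (FiberBundle.continuous_proj ℂ (E.pullback (incl (h'.trans h))).fiber))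
      (E.continuous_lift (incl (h'.trans h))))
  continuous_symm := E.continuous_to_pullback (incl (h'.trans h))
    (FiberBundle.continuous_proj ℂ ((E.pullback (incl h)).pullback (incl h')).fiber)
    ((E.continuous_lift (incl h)).comp ((E.pullback (incl h)).continuous_lift (incl h')))

/-- A hermitian line bundle: a complex line bundle with a positive definite hermitian form on each
fibre (conjugate-linear in the first variable) that depends continuously on the point. -/
structure HermitianLineBundle (X : Type u) [TopologicalSpace X] extends LineBundle.{u, v} X where
  metric : ∀ x, InnerProductSpace.Core ℂ (fiber x)
  continuous_metric : Continuous fun p : toLineBundle.Total₂ => (metric p.1).inner p.2.1 p.2.2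

/-- Pullback of a hermitian line bundle. -/
def HermitianLineBundle.pullback (E : HermitianLineBundle.{u, v} X) (f : C(Y, X)) :
    HermitianLineBundle.{u, v} Y where
  toLineBundle := E.toLineBundle.pullback f
  metric y := E.metric (f y)
  continuous_metric := E.continuous_metric.comp (E.toLineBundle.continuous_lift₂ f)

end LineBundle

/-! ### The fibred category of local square roots -/

section SquareRoot

variable {M : Type u} [TopologicalSpace M]

/-- An object of `√L` over the open set `U`: a line bundle `τ` over `U` with an isomorphism `ι`
from the tensor square `τ²` to `L|_U`. Continuity of `ι` on the bundle `τ ⊗ τ` is continuity of the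
associated bilinear map on the fibre product `τ ×_U τ`; the inverse of `ι` is then continuous
too, as for every continuous fibrewise isomorphism of vector bundles of finite rank. -/
structure SquareRoot (L : LineBundle.{u, v} M) (U : Opens M) where
  τ : LineBundle.{u, v} U
  ι : ∀ x : U, (τ.fiber x ⊗[ℂ] τ.fiber x) ≃ₗ[ℂ] L.fiber x
  continuous_ι : Continuous fun p : τ.Total₂ => (⟨p.1, ι p.1 (p.2.1 ⊗ₜ p.2.2)⟩ : L.Total)

namespace SquareRoot

variable {L : LineBundle.{u, v} M} {U V W : Opens M}

/-- A morphism `(τ, ι) ⟶ (τ', ι')`: an isomorphism `σ : τ → τ'` with `ι' ∘ σ² = ι`. -/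
@[ext]
structure Hom (O O' : SquareRoot L U) where
  σ : LineBundle.Iso O.τ O'.τ
  comm : ∀ (x : U) (t : O.τ.fiber x ⊗[ℂ] O.τ.fiber x),
    O'.ι x (TensorProduct.congr (σ.equiv x) (σ.equiv x) t) = O.ι x t

instance : Groupoid (SquareRoot L U) where
  Hom := Hom
  id O := ⟨LineBundle.Iso.refl _, fun x t => by simp [LineBundle.Iso.refl]⟩
  comp f g := ⟨f.σ.trans g.σ, fun x t => by
    rw [← f.comm, ← g.comm, LineBundle.Iso.trans, TensorProduct.congr_trans]
    rfl⟩
  inv f := ⟨f.σ.symm, fun x t => by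
    rw [← f.comm]
    congr 1
    exact (TensorProduct.congr (f.σ.equiv x) (f.σ.equiv x)).apply_symm_apply t⟩
  inv_comp f := by
    apply Hom.ext; apply LineBundle.Iso.ext; funext x; ext t
    exact (f.σ.equiv x).apply_symm_apply t
  comp_inv f := by
    apply Hom.ext; apply LineBundle.Iso.ext; funext x; ext t
    exact (f.σ.equiv x).symm_apply_apply t

@[ext]
theorem hom_ext {O O' : SquareRoot L U} {f g : O ⟶ O'}
    (h : ∀ x t, f.σ.equiv x t = g.σ.equiv x t) : f = g :=
  Hom.ext (LineBundle.Iso.ext (funext fun x => LinearEquiv.ext (h x)))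

@[simp]
theorem id_apply (O : SquareRoot L U) (x t) : (𝟙 O : O ⟶ O).σ.equiv x t = t := rfl

@[simp]
theorem comp_apply {O O' O'' : SquareRoot L U} (f : O ⟶ O') (g : O' ⟶ O'') (x t) :
    (f ≫ g).σ.equiv x t = g.σ.equiv x (f.σ.equiv x t) := rfl

/-- Restriction of square roots to a smaller open set. -/
def restrict (h : V ≤ U) : SquareRoot L U ⥤ SquareRoot L V where
  obj O :=
    { τ := O.τ.pullback (incl h)
      ι := fun x => O.ι (incl h x)
      continuous_ι := O.continuous_ι.comp (O.τ.continuous_lift₂ (incl h)) }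
  map f := ⟨f.σ.pullback (incl h), fun x t => f.comm (incl h x) t⟩

/-- The canonical identification of `O|_U` with `O`. -/
def restrictId (U : Opens M) : restrict (L := L) (le_refl U) ≅ 𝟭 (SquareRoot L U) :=
  NatIso.ofComponents (fun O => Groupoid.isoEquivHom _ _ |>.symm
    ⟨O.τ.pullbackId, fun x t => congrArg (O.ι x)
      (LinearEquiv.congr_fun (TensorProduct.congr_refl_refl (R := ℂ)) t)⟩)
    (fun _ => hom_ext fun _ _ => rfl)

/-- The canonical identification of `O|_W` with `(O|_V)|_W`. -/
def restrictComp (h : V ≤ U) (h' : W ≤ V) :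
    restrict (L := L) (h'.trans h) ≅ restrict h ⋙ restrict h' :=
  NatIso.ofComponents (fun O => Groupoid.isoEquivHom _ _ |>.symm
    ⟨O.τ.pullbackComp h h', fun x t => congrArg (O.ι (incl (h'.trans h) x))
      (LinearEquiv.congr_fun (TensorProduct.congr_refl_refl (R := ℂ)) t)⟩)
    (fun _ => hom_ext fun _ _ => rfl)

end SquareRoot

/-- The gerbe `√L`, as a fibred category: the groupoids of square roots of `L` over the open subsets
of `M`, with their restriction functors. -/
def sqrt (L : LineBundle.{u, v} M) :
    Pseudofunctor (LocallyDiscrete (Opens M)ᵒᵖ) Cat.{max u v, max u (v + 1)} :=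
  LocallyDiscrete.mkPseudofunctor
    (fun U => Cat.of (SquareRoot L U.unop))
    (fun f => (SquareRoot.restrict (leOfHom f.unop)).toCatHom)
    (fun U => Cat.Hom.isoMk (SquareRoot.restrictId U.unop))
    (fun f g => Cat.Hom.isoMk (SquareRoot.restrictComp (leOfHom f.unop) (leOfHom g.unop)))
    (fun f g h => by
      ext O
      apply SquareRoot.hom_ext
      intro x t
      rfl)
    (fun f => by
      ext O
      apply SquareRoot.hom_ext
      intro x t
      rfl)
    (fun f => by
      ext O
      apply SquareRoot.hom_ext
      intro x t
      rfl)

/-- A hermitian square root of a hermitian line bundle `H` over `U`: a square root `(τ, ι)` with a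
hermitian metric on `τ` for which `ι` is isometric, where the metric of `τ ⊗ τ` is
`⟨v ⊗ w, v' ⊗ w'⟩ = ⟨v, v'⟩⟨w, w'⟩`. -/
structure HermitianSquareRoot (H : HermitianLineBundle.{u, v} M) (U : Opens M) extends
    SquareRoot H.toLineBundle U where
  metric : ∀ x, InnerProductSpace.Core ℂ (τ.fiber x)
  continuous_metric : Continuous fun p : τ.Total₂ => (metric p.1).inner p.2.1 p.2.2
  isometry_ι : ∀ (x : U) (v w v' w' : τ.fiber x),
    (H.metric x).inner (ι x (v ⊗ₜ w)) (ι x (v' ⊗ₜ w')) =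
      (metric x).inner v v' * (metric x).inner w w'

namespace HermitianSquareRoot

variable {H : HermitianLineBundle.{u, v} M} {U V W : Opens M}

/-- A morphism of hermitian square roots is an isometric morphism of square roots. -/
@[ext]
structure Hom (O O' : HermitianSquareRoot H U) extends
    SquareRoot.Hom O.toSquareRoot O'.toSquareRoot where
  isometry : ∀ (x : U) (v w : O.τ.fiber x),
    (O'.metric x).inner (σ.equiv x v) (σ.equiv x w) = (O.metric x).inner v w

/-- The underlying morphism of square roots. -/
def Hom.under {O O' : HermitianSquareRoot H U} (f : Hom O O') :
    O.toSquareRoot ⟶ O'.toSquareRoot := f.toHom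

instance : Groupoid (HermitianSquareRoot H U) where
  Hom := Hom
  id O := ⟨𝟙 O.toSquareRoot, fun _ _ _ => rfl⟩
  comp f g := ⟨f.under ≫ g.under, fun x v w => (g.isometry x _ _).trans (f.isometry x v w)⟩
  inv f := ⟨Groupoid.inv f.under, fun x v w => by
    have := f.isometry x ((f.σ.equiv x).symm v) ((f.σ.equiv x).symm w)
    rw [LinearEquiv.apply_symm_apply, LinearEquiv.apply_symm_apply] at this
    exact this.symm⟩
  inv_comp f := Hom.ext (congrArg SquareRoot.Hom.σ (Groupoid.inv_comp f.under))
  comp_inv f := Hom.ext (congrArg SquareRoot.Hom.σ (Groupoid.comp_inv f.under))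

@[ext]
theorem hom_ext {O O' : HermitianSquareRoot H U} {f g : O ⟶ O'}
    (h : ∀ x t, f.σ.equiv x t = g.σ.equiv x t) : f = g :=
  Hom.ext (LineBundle.Iso.ext (funext fun x => LinearEquiv.ext (h x)))

@[simp]
theorem id_apply (O : HermitianSquareRoot H U) (x t) : (𝟙 O : O ⟶ O).σ.equiv x t = t := rfl

@[simp]
theorem comp_apply {O O' O'' : HermitianSquareRoot H U} (f : O ⟶ O') (g : O' ⟶ O'') (x t) :
    (f ≫ g).σ.equiv x t = g.σ.equiv x (f.σ.equiv x t) := rfl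

/-- Restriction of hermitian square roots to a smaller open set. -/
def restrict (h : V ≤ U) : HermitianSquareRoot H U ⥤ HermitianSquareRoot H V where
  obj O :=
    { (SquareRoot.restrict h).obj O.toSquareRoot with
      metric := fun x => O.metric (incl h x)
      continuous_metric := O.continuous_metric.comp (O.τ.continuous_lift₂ (incl h))
      isometry_ι := fun x => O.isometry_ι (incl h x) }
  map f := ⟨(SquareRoot.restrict h).map f.under, fun x => f.isometry (incl h x)⟩

/-- The canonical identification of `O|_U` with `O`. -/
def restrictId (U : Opens M) : restrict (H := H) (le_refl U) ≅ 𝟭 (HermitianSquareRoot H U) :=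
  NatIso.ofComponents (fun O => Groupoid.isoEquivHom _ _ |>.symm
    ⟨(SquareRoot.restrictId U).hom.app O.toSquareRoot, fun _ _ _ => rfl⟩)
    (fun _ => hom_ext fun _ _ => rfl)

/-- The canonical identification of `O|_W` with `(O|_V)|_W`. -/
def restrictComp (h : V ≤ U) (h' : W ≤ V) :
    restrict (H := H) (h'.trans h) ≅ restrict h ⋙ restrict h' :=
  NatIso.ofComponents (fun O => Groupoid.isoEquivHom _ _ |>.symm
    ⟨(SquareRoot.restrictComp h h').hom.app O.toSquareRoot, fun _ _ _ => rfl⟩)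
    (fun _ => hom_ext fun _ _ => rfl)

end HermitianSquareRoot

/-- The gerbe `√H`, as a fibred category, of hermitian square roots of a hermitian line bundle. -/
def hermitianSqrt (H : HermitianLineBundle.{u, v} M) :
    Pseudofunctor (LocallyDiscrete (Opens M)ᵒᵖ) Cat.{max u v, max u (v + 1)} :=
  LocallyDiscrete.mkPseudofunctor
    (fun U => Cat.of (HermitianSquareRoot H U.unop))
    (fun f => (HermitianSquareRoot.restrict (leOfHom f.unop)).toCatHom)
    (fun U => Cat.Hom.isoMk (HermitianSquareRoot.restrictId U.unop))
    (fun f g => Cat.Hom.isoMk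
      (HermitianSquareRoot.restrictComp (leOfHom f.unop) (leOfHom g.unop)))
    (fun f g h => by
      ext O
      apply HermitianSquareRoot.hom_ext
      intro x t
      rfl)
    (fun f => by
      ext O
      apply HermitianSquareRoot.hom_ext
      intro x t
      rfl)
    (fun f => by
      ext O
      apply HermitianSquareRoot.hom_ext
      intro x t
      rfl)

end SquareRoot

/-! ### Bands and the Giraud class -/

section Giraud

variable {M : Type u} [TopologicalSpace M]

/-- A fibred category over the open sets of `M` is banded by the discrete abelian group `A` when
the automorphism group of each object over `U` is identified with the group of locally constant
functions `U → A`, compatibly with morphisms and with restriction. -/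
structure Band (G : Pseudofunctor (LocallyDiscrete (Opens M)ᵒᵖ) Cat) (A : Type)
    [AddCommGroup A] where
  toAut : ∀ {U : Opens M} (O : G.obj (.mk (op U))),
    Multiplicative (LocallyConstant U A) ≃* Aut O
  natural : ∀ {U : Opens M} {O O' : G.obj (.mk (op U))} (f : O ⟶ O')
    (a : LocallyConstant U A),
    (toAut O (.ofAdd a)).hom ≫ f = f ≫ (toAut O' (.ofAdd a)).hom
  restrict : ∀ {U V : Opens M} (h : V ≤ U) (O : G.obj (.mk (op U))) (a : LocallyConstant U A),
    (G.map (homOfLE h).op.toLoc).toFunctor.map (toAut O (.ofAdd a)).hom =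
      (toAut ((G.map (homOfLE h).op.toLoc).toFunctor.obj O) (.ofAdd (resLC A h a))).hom

open Pseudofunctor.LocallyDiscreteOpToCat in
/-- `γ ∈ H²(M, A)` is a Giraud class of the banded fibred category `G`: for some open cover `U`
there are objects `O x` over `U x` and isomorphisms `σ x y` from `O y` to `O x` over
`U x ∩ U y`, such that the automorphisms `σ_{xy} ∘ σ_{yz} ∘ σ_{xz}⁻¹` of `O x` over
`U x ∩ U y ∩ U z` are given by a Čech cocycle with class `γ`. -/
def IsGiraudClass {G : Pseudofunctor (LocallyDiscrete (Opens M)ᵒᵖ) Cat} {A : Type}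
    [AddCommGroup A] (β : Band G A) (γ : H2 M A) : Prop :=
  ∃ (U : PointedCover M) (O : ∀ x, G.obj (.mk (op (U.set x))))
    (σ : ∀ x y,
      (G.map (homOfLE (inf_le_right : U.inter₂ x y ≤ U.set y)).op.toLoc).toFunctor.obj (O y) ≅
      (G.map (homOfLE (inf_le_left : U.inter₂ x y ≤ U.set x)).op.toLoc).toFunctor.obj (O x))
    (g : Z₂ A U), cls A U g = γ ∧ ∀ x y z,
    let px : U.inter₃ x y z ⟶ U.set x := homOfLE (inf_le_left.trans inf_le_left)
    let py : U.inter₃ x y z ⟶ U.set y := homOfLE (inf_le_left.trans inf_le_right)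
    let pz : U.inter₃ x y z ⟶ U.set z := homOfLE inf_le_right
    let pxy : U.inter₃ x y z ⟶ U.inter₂ x y := homOfLE inf_le_left
    let pyz : U.inter₃ x y z ⟶ U.inter₂ y z := homOfLE (inf_le_inf_right _ inf_le_right)
    let pxz : U.inter₃ x y z ⟶ U.inter₂ x z := homOfLE (inf_le_inf_right _ inf_le_left)
    pullHom (σ x z).inv pxz px pz ≫ pullHom (σ y z).hom pyz pz py ≫
      pullHom (σ x y).hom pxy py px =
    (β.toAut ((G.map px.op.toLoc).toFunctor.obj (O x)) (.ofAdd (g.1 x y z))).hom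

end Giraud

/-! ### The band of `√L` -/

section SqrtBand

/-- The identification of `ℤ/2` with the square roots of unity, `a ↦ (-1)^a`. -/
def sgn (a : ZMod 2) : ℂˣ := (-1) ^ a.val

theorem sgn_add (a b : ZMod 2) : sgn (a + b) = sgn a * sgn b := by
  have h : ∀ a b : ZMod 2, (a + b).val % 2 = (a.val + b.val) % 2 := by decide
  have h' : (-1 : ℂˣ) ^ 2 = 1 := by simp
  rw [sgn, sgn, sgn, ← pow_add, pow_eq_pow_mod _ h', h, ← pow_eq_pow_mod _ h']

theorem sgn_mul_self (a : ZMod 2) : (sgn a : ℂ) * sgn a = 1 := by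
  rw [← Units.val_mul, ← sgn_add, CharTwo.add_self_eq_zero]; simp [sgn]

theorem sgn_zero : (sgn 0 : ℂ) = 1 := by simp [sgn]

theorem sgn_one : (sgn 1 : ℂ) = -1 := by
  have : (1 : ZMod 2).val = 1 := rfl
  simp [sgn, this]

theorem sgn_injective : Function.Injective fun a => (sgn a : ℂ) := by
  have h : ∀ a : ZMod 2, a = 0 ∨ a = 1 := by decide
  intro a b hab
  rcases h a with rfl | rfl <;> rcases h b with rfl | rfl <;>
    first | rfl | (norm_num [sgn_one, sgn_zero] at hab)

namespace LineBundle

variable {X : Type u} [TopologicalSpace X] (E : LineBundle.{u, v} X)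

theorem continuous_sgn_smul (a : LocallyConstant X (ZMod 2)) :
    Continuous fun p : E.Total => (⟨p.1, (sgn (a p.1) : ℂ) • p.2⟩ : E.Total) := by
  rw [continuous_iff_continuousAt]
  intro p
  have hπ := (FiberBundle.continuous_proj ℂ E.fiber).continuousAt (x := p)
  rw [FiberBundle.continuousAt_totalSpace]
  refine ⟨hπ, ?_⟩
  have h₂ : ContinuousAt
      (fun q : E.Total => (sgn (a p.1) : ℂ) * (trivializationAt ℂ E.fiber p.1 q).2) p :=
    continuousAt_const.mul ((FiberBundle.continuousAt_totalSpace ℂ _).1 continuousAt_id).2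
  refine h₂.congr ?_
  filter_upwards [hπ.eventually ((trivializationAt ℂ E.fiber p.1).open_baseSet.mem_nhds
    (FiberBundle.mem_baseSet_trivializationAt ℂ E.fiber p.1)),
    hπ.eventually (a.isLocallyConstant.eventually_eq p.1)] with q hq hq'
  have := ((trivializationAt ℂ E.fiber p.1).linear ℂ hq).map_smul (sgn (a q.1) : ℂ) q.2
  have hq'' : a q.1 = a p.1 := hq'
  rw [smul_eq_mul, hq''] at this
  rw [hq'']
  exact this.symm

/-- Multiplication by the locally constant function `(-1)^a`. -/
def sgnIso (a : LocallyConstant X (ZMod 2)) : Iso E E where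
  equiv x := LinearEquiv.smulOfUnit (sgn (a x))
  continuous_equiv := E.continuous_sgn_smul a
  continuous_symm := by
    refine (E.continuous_sgn_smul a).congr fun p => ?_
    refine congrArg (TotalSpace.mk p.1) ?_
    refine ((LinearEquiv.smulOfUnit (sgn (a p.1))).symm_apply_eq.2 ?_).symm
    change p.2 = (sgn (a p.1) : ℂ) • (sgn (a p.1) : ℂ) • p.2
    rw [smul_smul, sgn_mul_self, one_smul]

theorem sgnIso_apply (a : LocallyConstant X (ZMod 2)) (x : X) (w : E.fiber x) :
    (E.sgnIso a).equiv x w = (sgn (a x) : ℂ) • w := rfl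

/-- The fibres of a line bundle are lines. -/
theorem exists_coord (x : X) : Nonempty (E.fiber x ≃ₗ[ℂ] ℂ) :=
  ⟨((trivializationAt ℂ E.fiber x).continuousLinearEquivAt ℂ x
    (FiberBundle.mem_baseSet_trivializationAt ℂ E.fiber x)).toLinearEquiv⟩

theorem sgnIso_injective : Function.Injective E.sgnIso := by
  intro a b h
  ext x
  obtain ⟨e⟩ := E.exists_coord x
  have h₁ : (sgn (a x) : ℂ) • e.symm 1 = (sgn (b x) : ℂ) • e.symm 1 := by
    rw [← sgnIso_apply, ← sgnIso_apply, h]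
  have h₂ := congrArg e h₁
  simp only [map_smul, LinearEquiv.apply_symm_apply, smul_eq_mul, mul_one] at h₂
  exact sgn_injective h₂

/-- An automorphism of a line bundle whose tensor square is the identity is multiplication by
`(-1)^a` for a locally constant function `a`. -/
theorem exists_sgnIso (σ : Iso E E)
    (h : ∀ x (w : E.fiber x), σ.equiv x w ⊗ₜ[ℂ] σ.equiv x w = w ⊗ₜ[ℂ] w) :
    ∃ a, E.sgnIso a = σ := by
  have hs : ∀ x, ∃ a : ZMod 2, ∀ w, σ.equiv x w = (sgn a : ℂ) • w := by
    intro x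
    obtain ⟨e⟩ := E.exists_coord x
    have hw : ∀ w, σ.equiv x w = e (σ.equiv x (e.symm 1)) • w := by
      intro w
      apply e.injective
      have : w = e w • e.symm 1 := by
        apply e.injective
        simp
      conv_lhs => rw [this]
      simp [mul_comm]
    set s := e (σ.equiv x (e.symm 1)) with hsdef
    have hs2 : s * s = 1 := by
      have := congrArg (fun t => LinearMap.mul' ℂ ℂ (TensorProduct.map e.toLinearMap e.toLinearMap t))
        (h x (e.symm 1))
      simpa [← hsdef] using this
    rcases mul_self_eq_one_iff.1 hs2 with h1 | h1
    · exact ⟨0, fun w => by rw [hw, h1]; simp [sgn]⟩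
    · exact ⟨1, fun w => by rw [hw, h1, sgn_one]⟩
  choose a ha using hs
  have hc : IsLocallyConstant a := by
    rw [IsLocallyConstant.iff_eventually_eq]
    intro x
    let e := trivializationAt ℂ E.fiber x
    have hx : x ∈ e.baseSet := FiberBundle.mem_baseSet_trivializationAt ℂ E.fiber x
    have hc₁ : ContinuousAt (fun y => (⟨y, e.symm y 1⟩ : E.Total)) x :=
      ((e.continuousOn_symm.comp (s := e.baseSet) (f := fun y => (y, (1 : ℂ)))
        (by fun_prop) (fun y hy => ⟨hy, trivial⟩)).continuousAt (e.open_baseSet.mem_nhds hx))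
    have hc₂ : ContinuousAt (fun y => (e ⟨y, σ.equiv y (e.symm y 1)⟩).2) x :=
      ((FiberBundle.continuousAt_totalSpace ℂ _).1
        (σ.continuous_equiv.continuousAt.comp hc₁)).2
    have he : ∀ y ∈ e.baseSet, (e ⟨y, σ.equiv y (e.symm y 1)⟩).2 = (sgn (a y) : ℂ) := by
      intro y hy
      rw [ha, (e.linear ℂ hy).map_smul]
      simp [e.apply_mk_symm hy]
    have hd : ∀ᶠ y in nhds x, dist (sgn (a y) : ℂ) (sgn (a x)) < 1 := by
      have := hc₂.eventually (Metric.ball_mem_nhds _ one_pos)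
      filter_upwards [this, e.open_baseSet.mem_nhds hx] with y hy hy'
      have hy : dist (e ⟨y, σ.equiv y (e.symm y 1)⟩).2 (e ⟨x, σ.equiv x (e.symm x 1)⟩).2 < 1 := hy
      rwa [he y hy', he x hx] at hy
    filter_upwards [hd] with y hy
    have h2 : ∀ c : ZMod 2, c = 0 ∨ c = 1 := by decide
    rcases h2 (a y) with h | h <;> rcases h2 (a x) with h' | h' <;>
      rw [h, h'] at hy ⊢ <;> exfalso <;>
      norm_num [sgn_one, sgn_zero, dist_eq_norm] at hy
  refine ⟨⟨a, hc⟩, ?_⟩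
  apply Iso.ext; funext x; ext w
  exact (ha x w).symm

end LineBundle

variable {M : Type u} [TopologicalSpace M]

namespace SquareRoot

variable {L : LineBundle.{u, v} M} {U : Opens M}

/-- The automorphism `(-1)^a` of a square root. -/
def sgnHom (O : SquareRoot L U) (a : LocallyConstant U (ZMod 2)) : O ⟶ O :=
  ⟨O.τ.sgnIso a, fun x t => by
    refine congrArg (O.ι x) ?_
    induction t with
    | zero => simp
    | add s t hs ht => rw [map_add, hs, ht]
    | tmul w w' =>
      rw [TensorProduct.congr_tmul, LineBundle.sgnIso_apply, LineBundle.sgnIso_apply,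
        TensorProduct.smul_tmul_smul, sgn_mul_self, one_smul]⟩

theorem sgnHom_apply (O : SquareRoot L U) (a : LocallyConstant U (ZMod 2)) (x : U)
    (w : O.τ.fiber x) : (O.sgnHom a).σ.equiv x w = (sgn (a x) : ℂ) • w := rfl

theorem sgnHom_add (O : SquareRoot L U) (a b : LocallyConstant U (ZMod 2)) :
    O.sgnHom (a + b) = O.sgnHom b ≫ O.sgnHom a := by
  ext x w
  rw [comp_apply, sgnHom_apply, sgnHom_apply, sgnHom_apply, smul_smul, ← Units.val_mul,
    ← sgn_add]
  rfl

theorem sgnHom_injective (O : SquareRoot L U) : Function.Injective O.sgnHom := fun _ _ h =>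
  O.τ.sgnIso_injective (congrArg Hom.σ h)

theorem sgnHom_surjective (O : SquareRoot L U) : Function.Surjective O.sgnHom := by
  intro f
  obtain ⟨a, ha⟩ := O.τ.exists_sgnIso f.σ fun x w => by
    have := (O.ι x).injective (f.comm x (w ⊗ₜ w))
    rwa [TensorProduct.congr_tmul] at this
  exact ⟨a, Hom.ext ha⟩

/-- The identification of the automorphism group. -/
def autEquiv (O : SquareRoot L U) : Multiplicative (LocallyConstant U (ZMod 2)) ≃* Aut O :=
  have h : Function.Bijective O.sgnHom := ⟨O.sgnHom_injective, O.sgnHom_surjective⟩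
  { toEquiv := (Multiplicative.toAdd.trans (Equiv.ofBijective O.sgnHom h)).trans
      (Groupoid.isoEquivHom O O).symm
    map_mul' := fun a b => Iso.ext (O.sgnHom_add a.toAdd b.toAdd) }

end SquareRoot

/-- The automorphisms of a square root of `L` are the signs `(-1)^a`, `a : U → ℤ/2` locally
constant. -/
def sqrtBand (L : LineBundle.{u, v} M) : Band (sqrt L) (ZMod 2) where
  toAut {U} O := SquareRoot.autEquiv (U := U) O
  natural {U} {O O'} f a := by
    apply SquareRoot.hom_ext
    intro x w
    exact ((SquareRoot.Hom.σ f).equiv x).map_smul _ w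
  restrict _ _ _ := SquareRoot.hom_ext fun _ _ => rfl

namespace HermitianSquareRoot

variable {H : HermitianLineBundle.{u, v} M} {U : Opens M}

/-- The automorphism `(-1)^a` of a hermitian square root. -/
def sgnHom (O : HermitianSquareRoot H U) (a : LocallyConstant U (ZMod 2)) : O ⟶ O :=
  ⟨O.toSquareRoot.sgnHom a, fun x w w' => by
    let c := O.metric x
    change c.inner ((sgn (a x) : ℂ) • w) ((sgn (a x) : ℂ) • w') = c.inner w w'
    have h₂ : ∀ b : ZMod 2, b = 0 ∨ b = 1 := by decide
    rcases h₂ (a x) with h | h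
    · rw [h, sgn_zero, one_smul, one_smul]
    · rw [h, sgn_one, c.smul_left, ← c.conj_inner_symm, c.smul_left, map_mul,
        c.conj_inner_symm]
      simp⟩

theorem sgnHom_add (O : HermitianSquareRoot H U) (a b : LocallyConstant U (ZMod 2)) :
    O.sgnHom (a + b) = O.sgnHom b ≫ O.sgnHom a :=
  Hom.ext (congrArg SquareRoot.Hom.σ (O.toSquareRoot.sgnHom_add a b))

theorem sgnHom_injective (O : HermitianSquareRoot H U) : Function.Injective O.sgnHom :=
  fun _ _ h => O.τ.sgnIso_injective (congrArg (fun f => f.σ) h)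

theorem sgnHom_surjective (O : HermitianSquareRoot H U) : Function.Surjective O.sgnHom := by
  intro f
  obtain ⟨a, ha⟩ := O.toSquareRoot.sgnHom_surjective f.under
  exact ⟨a, Hom.ext (congrArg SquareRoot.Hom.σ ha)⟩

/-- The identification of the automorphism group. -/
def autEquiv (O : HermitianSquareRoot H U) : Multiplicative (LocallyConstant U (ZMod 2)) ≃* Aut O :=
  have h : Function.Bijective O.sgnHom := ⟨O.sgnHom_injective, O.sgnHom_surjective⟩
  { toEquiv := (Multiplicative.toAdd.trans (Equiv.ofBijective O.sgnHom h)).trans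
      (Groupoid.isoEquivHom O O).symm
    map_mul' := fun a b => Iso.ext (O.sgnHom_add a.toAdd b.toAdd) }

end HermitianSquareRoot

/-- The automorphisms of a hermitian square root of `H` are the signs `(-1)^a`, `a : U → ℤ/2`
locally constant. -/
def hermitianSqrtBand (H : HermitianLineBundle.{u, v} M) : Band (hermitianSqrt H) (ZMod 2) where
  toAut {U} O := HermitianSquareRoot.autEquiv (U := U) O
  natural {U} {O O'} f a := by
    apply HermitianSquareRoot.hom_ext
    intro x w
    exact ((HermitianSquareRoot.Hom.toHom f).σ.equiv x).map_smul _ w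
  restrict _ _ _ := HermitianSquareRoot.hom_ext fun _ _ => rfl

end SqrtBand

/-! ### The Chern class -/

section Chern

variable {M : Type u} [TopologicalSpace M]

/-- `c ∈ H²(M, ℤ)` is a Chern class of `L`: for some open cover `U` there are trivializations `ε x`
of `L` over `U x` and continuous logarithms `θ x y` of the transition functions,
`ε_x ∘ ε_y⁻¹ = exp (2πi θ_{xy})` on `U x ∩ U y`, such that the integers
`θ_{xy} + θ_{yz} - θ_{xz}` form a Čech cocycle with class `c`. -/
def IsChernClass (L : LineBundle.{u, v} M) (c : H2 M ℤ) : Prop :=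
  ∃ (U : PointedCover M) (ε : M → Trivialization ℂ (π ℂ L.fiber))
    (θ : ∀ x y, C(U.inter₂ x y, ℂ)) (n : Z₂ ℤ U),
    (∀ x, (ε x).IsLinear ℂ ∧ (U.set x : Set M) ⊆ (ε x).baseSet) ∧
    (∀ x y (p : U.inter₂ x y) (w : L.fiber p),
      (ε x ⟨p, w⟩).2 = Complex.exp (2 * Real.pi * Complex.I * θ x y p) * (ε y ⟨p, w⟩).2) ∧
    (∀ x y z (p : U.inter₃ x y z), ((n.1 x y z p : ℤ) : ℂ) =
      θ x y ⟨p, p.2.1⟩ + θ y z ⟨p, p.2.1.2, p.2.2⟩ - θ x z ⟨p, p.2.1.1, p.2.2⟩) ∧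
    cls ℤ U n = c

/-- The Chern class of a hermitian line bundle, computed in the same way from isometric
trivializations and real logarithms of their `U(1)`-valued transition functions. -/
def IsHermitianChernClass (H : HermitianLineBundle.{u, v} M) (c : H2 M ℤ) : Prop :=
  ∃ (U : PointedCover M) (ε : M → Trivialization ℂ (π ℂ H.fiber))
    (θ : ∀ x y, C(U.inter₂ x y, ℝ)) (n : Z₂ ℤ U),
    (∀ x, (ε x).IsLinear ℂ ∧ (U.set x : Set M) ⊆ (ε x).baseSet) ∧
    (∀ x (p : U.set x) (w w' : H.fiber p),
      (H.metric p).inner w w' = inner ℂ (ε x ⟨p, w⟩).2 (ε x ⟨p, w'⟩).2) ∧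
    (∀ x y (p : U.inter₂ x y) (w : H.fiber p),
      (ε x ⟨p, w⟩).2 = Complex.exp (2 * Real.pi * Complex.I * θ x y p) * (ε y ⟨p, w⟩).2) ∧
    (∀ x y z (p : U.inter₃ x y z), ((n.1 x y z p : ℤ) : ℝ) =
      θ x y ⟨p, p.2.1⟩ + θ y z ⟨p, p.2.1.2, p.2.2⟩ - θ x z ⟨p, p.2.1.1, p.2.2⟩) ∧
    cls ℤ U n = c

end Chern

end SqrtGerbe

end

/-! A trivialization `ε` of the line bundle `L` over `U` turns `L|_U` itself into a square root, by
`v ⊗ w ↦ ε(v) w`. If `ε_x = exp(2πiθ_{xy}) ε_y`, multiplication by `exp(-πiθ_{xy})` is a morphism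
from the root of `ε_y` to that of `ε_x`, since its square compensates the change of trivialization.
These morphisms fail to compose by `exp(-πi(θ_{xy} + θ_{yz} - θ_{xz})) = (-1)^{c_{xyz}}`, so Chern
data yield Giraud data whose cocycle is the reduction of the Chern cocycle
(`IsChernClass.isGiraudClass_mod2`). Once both classes are known to be unique and a Chern class to
exist, everything follows, including the existence of the Giraud class.

Uniqueness is a comparison of choices. Any two square roots are locally isomorphic, because a ratio
of squares of local frames has a local continuous square root, and parallel morphisms differ by a
sign; these signs form a cochain bounding the difference of the cocycles
(`SquareRoot.GiraudData.cls_eq`). For Chern data, logarithms of the ratios of trivializations play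
the same role (`IsChernClass.eq`). Covers indexed by points make this easy: the comparison at `x` is
needed only on some neighbourhood of `x`.

Existence of Chern data requires logarithms on whole double intersections, and this is where
paracompactness enters (`PointedCover.exists_refinement`).

In the hermitian case, rescaling makes local trivializations isometric, the logarithms are then
automatically real, and `exp(-πiθ)` is unitary. Uniqueness is inherited from the complex case by
forgetting the metrics. -/

noncomputable section

namespace SqrtGerbe

/-! ### Refinement of covers, local logarithms, integer-valued functions -/

section Topology

variable {M : Type u} [TopologicalSpace M]

/-- On a paracompact Hausdorff space, a hereditary property of open sets that holds locally on the
double intersections of a cover holds on the double intersections of a suitable refinement. -/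
theorem PointedCover.exists_refinement [T2Space M] [ParacompactSpace M] (W : PointedCover M)
    (P : M → M → Opens M → Prop) (mono : ∀ x y V V', V' ≤ V → P x y V → P x y V')
    (bot : ∀ x y, P x y ⊥) (loc : ∀ x y, ∀ p ∈ W.inter₂ x y, ∃ V, p ∈ V ∧ P x y V) :
    ∃ (V : PointedCover M) (t : M → M), (∀ p, V.set p ≤ W.set (t p)) ∧
      ∀ p q, P (t p) (t q) (V.inter₂ p q) := by
  obtain ⟨u, hu, hcov, hfin, huW⟩ := precise_refinement (fun x => (W.set x : Set M))
    (fun x => (W.set x).isOpen) (Set.eq_univ_of_forall fun x => Set.mem_iUnion.2 ⟨x, W.mem x⟩)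
  -- Shrinking makes the closures locally finite and still subordinate to `W`; closedness is what
  -- allows a point to be separated from all members that miss it.
  obtain ⟨G, hG, hGo, hGu⟩ := exists_iUnion_eq_closure_subset hu hfin.point_finite hcov
  have hF : LocallyFinite fun i => closure (G i) := hfin.subset hGu
  have hGW : ∀ i, closure (G i) ⊆ W.set i := fun i => (hGu i).trans (huW i)
  have ht : ∀ p, ∃ i, p ∈ G i := fun p => Set.mem_iUnion.1 (hG ▸ Set.mem_univ p)
  choose t ht using ht
  have hN : ∀ p x y, ∃ N : Opens M, p ∈ N ∧ (p ∈ W.inter₂ x y → P x y N) := by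
    intro p x y
    by_cases h : p ∈ W.inter₂ x y
    · obtain ⟨V, hV, hP⟩ := loc x y p h
      exact ⟨V, hV, fun _ => hP⟩
    · exact ⟨⊤, trivial, fun h' => (h h').elim⟩
  choose N hpN hN using hN
  let S : M → Set M := fun p => {i | p ∈ closure (G i)}
  -- `A p` lies in one member containing `p`, avoids every closure that misses `p`, and lies in the
  -- good neighbourhoods `N p i j` for the finitely many closures that contain `p`. By local
  -- finiteness it is a neighbourhood of `p`.
  let A : M → Set M := fun p => G (t p) ∩ ((⋂ i, ⋂ (_ : p ∉ closure (G i)), (closure (G i))ᶜ) ∩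
    ⋂ i ∈ S p, ⋂ j ∈ S p, (N p i j : Set M))
  have hA : ∀ p, A p ∈ nhds p := fun p =>
    Filter.inter_mem ((hGo _).mem_nhds (ht p)) (Filter.inter_mem
      (hF.iInter_compl_mem_nhds (fun _ => isClosed_closure) p)
      ((Filter.biInter_mem (hF.point_finite p)).2 fun i _ =>
        (Filter.biInter_mem (hF.point_finite p)).2 fun j _ =>
          (N p i j).isOpen.mem_nhds (hpN p i j)))
  refine ⟨⟨fun p => ⟨interior (A p), isOpen_interior⟩, fun p => mem_interior_iff_mem_nhds.2 (hA p)⟩,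
    t, fun p q hq => hGW _ (subset_closure (interior_subset hq).1), fun p q => ?_⟩
  rcases Set.eq_empty_or_nonempty (interior (A p) ∩ interior (A q)) with h | ⟨r, hr, hr'⟩
  · exact mono _ _ _ _ (fun r hr => (h.subset hr : r ∈ (∅ : Set M))) (bot _ _)
  · have hp : p ∈ closure (G (t p)) := subset_closure (ht p)
    -- If `closure (G (t q))` missed `p`, then `A p` would avoid it; but the common point `r` lies
    -- in `G (t q)`. So `N p (t p) (t q)` is one of the sets cut out in `A p`, and it is good.
    have hq : p ∈ closure (G (t q)) := by
      by_contra hq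
      have := Set.mem_iInter₂.1 (interior_subset hr).2.1 (t q) hq
      exact this (subset_closure (interior_subset hr').1)
    refine mono _ _ _ _ ?_ (hN p (t p) (t q) ⟨hGW _ hp, hGW _ hq⟩)
    intro s hs
    exact Set.mem_iInter₂.1 (Set.mem_iInter₂.1 (interior_subset hs.1).2.2 (t p) hp) (t q) hq

/-- A continuous function without zeros has local logarithms. -/
theorem exists_local_log {U : Opens M} (f : C(U, ℂ)) (h₀ : ∀ p, f p ≠ 0) (x : U) :
    ∃ V : Opens M, ∃ h : V ≤ U, x.1 ∈ V ∧ ∃ θ : C(V, ℂ),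
      ∀ p : V, Complex.exp (2 * Real.pi * Complex.I * θ p) = f (incl h p) := by
  -- Division by `f x` moves the value at `x` to `1`, inside the domain of continuity of the
  -- principal logarithm; the constant `log (f x)` is added back afterwards.
  let S : Set U := (fun p => f p / f x) ⁻¹' Complex.slitPlane
  have hS : IsOpen S := Complex.isOpen_slitPlane.preimage (f.continuous.div_const _)
  let V : Opens M := ⟨Subtype.val '' S, U.isOpen.isOpenMap_subtype_val _ hS⟩
  have hV : V ≤ U := by rintro _ ⟨p, -, rfl⟩; exact p.2
  have hVS : ∀ p : V, incl hV p ∈ S := by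
    rintro ⟨_, p, hp, rfl⟩
    exact hp
  refine ⟨V, hV, ⟨x, ?_, rfl⟩, ⟨fun p => (Complex.log (f (incl hV p) / f x) + Complex.log (f x)) /
    (2 * Real.pi * Complex.I), ?_⟩, fun p => ?_⟩
  · change f x / f x ∈ Complex.slitPlane
    simp [div_self (h₀ x)]
  · refine Continuous.div_const (Continuous.add ?_ continuous_const) _
    exact Continuous.clog ((f.continuous.comp (incl hV).continuous).div_const _) hVS
  · change Complex.exp (2 * Real.pi * Complex.I * (_ / (2 * Real.pi * Complex.I))) = _
    rw [mul_div_cancel₀ _ Complex.two_pi_I_ne_zero, Complex.exp_add,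
      Complex.exp_log (div_ne_zero (h₀ _) (h₀ x)), Complex.exp_log (h₀ x),
      div_mul_cancel₀ _ (h₀ x)]

/-- A continuous function with integral values is locally constant. -/
theorem exists_locallyConstant_int {X : Type*} [TopologicalSpace X] (f : C(X, ℂ))
    (h : ∀ x, ∃ n : ℤ, f x = n) : ∃ n : LocallyConstant X ℤ, ∀ x, (n x : ℂ) = f x := by
  choose n hn using h
  refine ⟨⟨n, (IsLocallyConstant.iff_continuous n).2 ?_⟩, fun x => (hn x).symm⟩
  rw [Int.isClosedEmbedding_coe_real.isEmbedding.continuous_iff]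
  refine (Complex.continuous_re.comp f.continuous).congr fun x => ?_
  simp [hn]

end Topology

/-! ### Equality of Čech classes and reduction of coefficients -/

section Cech

variable {M : Type u} [TopologicalSpace M] {A : Type} [AddCommGroup A]

theorem mem_Z₂_iff {U : PointedCover M} {c : C₂ A U} : c ∈ Z₂ A U ↔ ∀ x y z w,
    ∀ p : U.inter₄ x y z w,
      c y z w ⟨p, ⟨p.2.1.1.2, p.2.1.2⟩, p.2.2⟩ - c x z w ⟨p, ⟨p.2.1.1.1, p.2.1.2⟩, p.2.2⟩
        + c x y w ⟨p, p.2.1.1, p.2.2⟩ - c x y z ⟨p, p.2.1⟩ = 0 := by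
  refine ⟨fun h x y z w p => ?_, fun h => ?_⟩
  · exact DFunLike.congr_fun (congrFun (congrFun (congrFun (congrFun h x) y) z) w) p
  · ext x y z w p
    exact h x y z w p

theorem cls_refineZ₂ {U V : PointedCover M} (h : U ≤ V) (g : Z₂ A U) :
    cls A V (refineZ₂ A h g) = cls A U g := by
  classical
  exact AddCommGroup.DirectLimit.of_f (G := fun U : PointedCover M => HCover A U)
    (f := fun _ _ h => refineH A h) h (QuotientAddGroup.mk' _ g)

/-- Cocycles that are cohomologous on a common refinement have the same class. -/
theorem cls_eq_cls {U U' V : PointedCover M} (h : U ≤ V) (h' : U' ≤ V) (g : Z₂ A U) (g' : Z₂ A U')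
    (b : C₁ A V)
    (hb : ∀ x y z, ∀ p : V.inter₃ x y z,
      g.1 x y z ⟨p, ⟨h x p.2.1.1, h y p.2.1.2⟩, h z p.2.2⟩ -
        g'.1 x y z ⟨p, ⟨h' x p.2.1.1, h' y p.2.1.2⟩, h' z p.2.2⟩ =
      b y z ⟨p, p.2.1.2, p.2.2⟩ - b x z ⟨p, p.2.1.1, p.2.2⟩ + b x y ⟨p, p.2.1⟩) :
    cls A U g = cls A U' g' := by
  classical
  rw [← cls_refineZ₂ h g, ← cls_refineZ₂ h' g']
  -- The quotient relation asks for `-g' + g` to be a coboundary, so the equality is proved from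
  -- `g'` to `g` and reversed.
  refine (congrArg (AddCommGroup.DirectLimit.of (fun U : PointedCover M => HCover A U)
    (fun _ _ h => refineH A h) V) (QuotientAddGroup.eq.2 ⟨b, ?_⟩)).symm
  ext x y z p
  exact (hb x y z p).symm.trans ((sub_eq_add_neg _ _).trans (add_comm _ _))

theorem mod2_cls (U : PointedCover M) (n : Z₂ ℤ U) :
    mod2 M (cls ℤ U n) = cls (ZMod 2) U (coeffZ₂ (Int.castAddHom (ZMod 2)) U n) := by
  classical
  exact AddCommGroup.DirectLimit.map_apply_of (G := fun U : PointedCover M => HCover ℤ U)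
    (f := fun _ _ h => refineH ℤ h) (G' := fun U : PointedCover M => HCover (ZMod 2) U)
    (f' := fun _ _ h => refineH (ZMod 2) h) (fun U => coeffH (Int.castAddHom (ZMod 2)) U)
    (fun _ _ _ => by ext; rfl) (QuotientAddGroup.mk' _ n)

end Cech

/-! ### Continuity of scalar multiplication -/

section LineBundle

variable {X : Type u} [TopologicalSpace X] {Y : Type u} [TopologicalSpace Y]

namespace LineBundle

/-- Continuity of fibrewise multiplication by scalars. -/
theorem continuous_smul (E : LineBundle.{u, v} X) {T : Type*} [TopologicalSpace T] {c : T → ℂ}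
    (hc : Continuous c) {g : T → E.Total} (hg : Continuous g) :
    Continuous fun t => (⟨(g t).1, c t • (g t).2⟩ : E.Total) := by
  rw [continuous_iff_continuousAt]
  intro t
  obtain ⟨h₁, h₂⟩ := (FiberBundle.continuousAt_totalSpace ℂ g).1 hg.continuousAt
  rw [FiberBundle.continuousAt_totalSpace]
  refine ⟨h₁, (hc.continuousAt.mul h₂).congr ?_⟩
  filter_upwards [h₁.eventually ((trivializationAt ℂ E.fiber (g t).1).open_baseSet.mem_nhds
    (FiberBundle.mem_baseSet_trivializationAt ℂ E.fiber (g t).1))] with s hs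
  exact (((trivializationAt ℂ E.fiber (g t).1).linear ℂ hs).map_smul (c s) (g s).2).symm

end LineBundle

end LineBundle

/-! ### Tensor squares of lines -/

section LinearAlgebra

/-- Compatibility with isomorphisms from the tensor squares of lines to a line can be checked on a
basis vector. -/
theorem apply_congr_eq_of_apply_basis {A B C : Type*} [AddCommGroup A] [Module ℂ A]
    [AddCommGroup B] [Module ℂ B] [AddCommGroup C] [Module ℂ C] (ι : A ⊗[ℂ] A ≃ₗ[ℂ] C)
    (ι' : B ⊗[ℂ] B ≃ₗ[ℂ] C) (σ : A ≃ₗ[ℂ] B) (a : A ≃ₗ[ℂ] ℂ) (l : C ≃ₗ[ℂ] ℂ) {b : B} {k : ℂ}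
    (hσ : σ (a.symm 1) = k • b)
    (h : k * k * l (ι' (b ⊗ₜ b)) = l (ι (a.symm 1 ⊗ₜ a.symm 1))) (t : A ⊗[ℂ] A) :
    ι' (TensorProduct.congr σ σ t) = ι t := by
  have hs : ι' (σ (a.symm 1) ⊗ₜ σ (a.symm 1)) = ι (a.symm 1 ⊗ₜ a.symm 1) := by
    apply l.injective
    rw [hσ, TensorProduct.smul_tmul_smul, map_smul, map_smul, smul_eq_mul, h]
  have hw : ∀ w, w = a w • a.symm 1 := fun w => a.injective (by simp)
  have hφ : ι'.toLinearMap ∘ₗ (TensorProduct.congr σ σ).toLinearMap = ι.toLinearMap := by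
    refine TensorProduct.ext' fun w w' => ?_
    rw [hw w, hw w', TensorProduct.smul_tmul_smul, map_smul, map_smul]
    exact congrArg (_ • ·) hs
  exact LinearMap.congr_fun hφ t

end LinearAlgebra

/-! ### Isomorphisms of line bundles in local coordinates -/

section LineBundle

variable {X : Type u} [TopologicalSpace X] {X' : Type u} [TopologicalSpace X']
  {Y : Type u} [TopologicalSpace Y]

namespace LineBundle

theorem continuous_triv (E : LineBundle.{u, v} X) (e : Trivialization ℂ (π ℂ E.fiber))
    {T : Type*} [TopologicalSpace T] {g : T → E.Total} (hg : Continuous g)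
    (h : ∀ t, (g t).1 ∈ e.baseSet) : Continuous fun t => (e (g t)).2 :=
  continuous_snd.comp (e.continuousOn.comp_continuous hg fun t => e.mem_source.2 (h t))

theorem continuous_triv_symm (E : LineBundle.{u, v} X) (e : Trivialization ℂ (π ℂ E.fiber))
    {T : Type*} [TopologicalSpace T] {f : T → X} (hf : Continuous f) {c : T → ℂ}
    (hc : Continuous c) (h : ∀ t, f t ∈ e.baseSet) :
    Continuous fun t => (⟨f t, e.symm (f t) (c t)⟩ : E.Total) :=
  e.continuousOn_symm.comp_continuous (hf.prodMk hc) fun t => ⟨h t, trivial⟩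

/-- The inverse of such a map has the same shape, with the trivializations exchanged and `c⁻¹` in
place of `c`. One continuity statement thus serves both directions of `trivIso`. -/
theorem continuous_transport (E : LineBundle.{u, v} X) (E' : LineBundle.{u, v} X')
    (e : Trivialization ℂ (π ℂ E.fiber)) (e' : Trivialization ℂ (π ℂ E'.fiber)) (f : C(Y, X))
    (f' : C(Y, X')) (hf : ∀ y, f y ∈ e.baseSet) (hf' : ∀ y, f' y ∈ e'.baseSet) {c : Y → ℂ}
    (hc : Continuous c) : Continuous fun q : (E.pullback f).Total =>
      (⟨q.1, e'.symm (f' q.1) (c q.1 * (e ⟨f q.1, q.2⟩).2)⟩ : (E'.pullback f').Total) := by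
  have hπ := FiberBundle.continuous_proj ℂ (E.pullback f).fiber
  refine E'.continuous_to_pullback f' hπ ?_
  exact E'.continuous_triv_symm e' (f'.continuous.comp hπ)
    ((hc.comp hπ).mul (E.continuous_triv e (E.continuous_lift f) fun q => hf q.1))
    fun q => hf' q.1

/-- The isomorphism of pullbacks of line bundles given by a continuous function without zeros in
terms of trivializations. -/
def trivIso (E : LineBundle.{u, v} X) (E' : LineBundle.{u, v} X')
    (e : Trivialization ℂ (π ℂ E.fiber)) (e' : Trivialization ℂ (π ℂ E'.fiber))
    [e.IsLinear ℂ] [e'.IsLinear ℂ] (f : C(Y, X))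
    (f' : C(Y, X')) (hf : ∀ y, f y ∈ e.baseSet) (hf' : ∀ y, f' y ∈ e'.baseSet) (c : Y → ℂ)
    (hc : Continuous c) (h₀ : ∀ y, c y ≠ 0) : Iso (E.pullback f) (E'.pullback f') where
  equiv y := ((e.linearEquivAt ℂ (f y) (hf y)).trans
    (LinearEquiv.smulOfUnit (Units.mk0 (c y) (h₀ y)))).trans
      (e'.linearEquivAt ℂ (f' y) (hf' y)).symm
  continuous_equiv := continuous_transport E E' e e' f f' hf hf' hc
  continuous_symm := continuous_transport E' E e' e f' f hf' hf (hc.inv₀ h₀)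

/-- Supplies the hypothesis `hσ` of `apply_congr_eq_of_apply_basis`, which reduces compatibility
with `ι` to a scalar identity between squares of frames. -/
theorem trivIso_symm_one (E : LineBundle.{u, v} X) (E' : LineBundle.{u, v} X')
    (e : Trivialization ℂ (π ℂ E.fiber)) (e' : Trivialization ℂ (π ℂ E'.fiber))
    [e.IsLinear ℂ] [e'.IsLinear ℂ] (f : C(Y, X))
    (f' : C(Y, X')) (hf : ∀ y, f y ∈ e.baseSet) (hf' : ∀ y, f' y ∈ e'.baseSet) (c : Y → ℂ)
    (hc : Continuous c) (h₀ : ∀ y, c y ≠ 0) (y : Y) :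
    (trivIso E E' e e' f f' hf hf' c hc h₀).equiv y (e.symm (f y) 1) =
      c y • e'.symm (f' y) 1 := by
  change (e'.linearEquivAt ℂ (f' y) (hf' y)).symm (c y * (e ⟨f y, e.symm (f y) 1⟩).2) =
    c y • (e'.linearEquivAt ℂ (f' y) (hf' y)).symm 1
  rw [← map_smul, e.apply_mk_symm (hf y), smul_eq_mul]

theorem continuous_mk₂ (E : LineBundle.{u, v} X) {T : Type*} [TopologicalSpace T] {f : T → X}
    {v w : ∀ t, E.fiber (f t)} (hv : Continuous fun t => (⟨f t, v t⟩ : E.Total))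
    (hw : Continuous fun t => (⟨f t, w t⟩ : E.Total)) :
    Continuous fun t => (⟨f t, (v t, w t)⟩ : E.Total₂) :=
  (FiberBundle.Prod.isInducing_diag ℂ E.fiber ℂ E.fiber).continuous_iff.2 (hv.prodMk hw)

end LineBundle

end LineBundle

/-! ### Local uniqueness of square roots -/

section SquareRoot

variable {M : Type u} [TopologicalSpace M] {L : LineBundle.{u, v} M}

namespace SquareRoot

variable {U U' : Opens M}

/-- The square of the local frame of `τ` given by `e`, in the trivialization `l` of `L`. -/
def frameSq (O : SquareRoot L U) (e : Trivialization ℂ (π ℂ O.τ.fiber))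
    (l : Trivialization ℂ (π ℂ L.fiber)) (p : U) : ℂ :=
  (l ⟨p, O.ι p (e.symm p 1 ⊗ₜ e.symm p 1)⟩).2

theorem continuous_frameSq (O : SquareRoot L U) (e : Trivialization ℂ (π ℂ O.τ.fiber))
    (l : Trivialization ℂ (π ℂ L.fiber)) {T : Type*} [TopologicalSpace T] {f : T → U}
    (hf : Continuous f) (he : ∀ t, f t ∈ e.baseSet) (hl : ∀ t, (f t : M) ∈ l.baseSet) :
    Continuous fun t => O.frameSq e l (f t) := by
  have hs := O.τ.continuous_triv_symm e hf (continuous_const (y := (1 : ℂ))) he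
  exact L.continuous_triv l (O.continuous_ι.comp (O.τ.continuous_mk₂ hs hs)) hl

/-- Both `ι` and the coordinate of `l` are injective, and `a ⊗ a` followed by multiplication sends
the square of the frame vector to `1`. -/
theorem frameSq_ne_zero (O : SquareRoot L U) (e : Trivialization ℂ (π ℂ O.τ.fiber))
    (l : Trivialization ℂ (π ℂ L.fiber)) [e.IsLinear ℂ] [l.IsLinear ℂ] {p : U}
    (he : p ∈ e.baseSet) (hl : (p : M) ∈ l.baseSet) : O.frameSq e l p ≠ 0 := by
  let a := e.linearEquivAt ℂ p he
  intro h
  have h₁ : O.ι p (a.symm 1 ⊗ₜ a.symm 1) = 0 :=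
    (l.linearEquivAt ℂ (p : M) hl).map_eq_zero_iff.1 h
  have h₂ := congrArg (fun t => LinearMap.mul' ℂ ℂ (TensorProduct.map a.toLinearMap a.toLinearMap t))
    ((O.ι p).map_eq_zero_iff.1 h₁)
  simp at h₂

/-- Any two square roots are locally isomorphic. -/
theorem exists_local_hom (O : SquareRoot L U) (O' : SquareRoot L U') {x : M} (hx : x ∈ U)
    (hx' : x ∈ U') : ∃ (V : Opens M) (h : V ≤ U) (h' : V ≤ U'), x ∈ V ∧
      Nonempty ((restrict h).obj O ⟶ (restrict h').obj O') := by
  let e := trivializationAt ℂ O.τ.fiber ⟨x, hx⟩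
  let e' := trivializationAt ℂ O'.τ.fiber ⟨x, hx'⟩
  let l := trivializationAt ℂ L.fiber x
  let W : Opens M := ⟨(Subtype.val '' e.baseSet ∩ Subtype.val '' e'.baseSet) ∩ l.baseSet,
    ((U.isOpen.isOpenMap_subtype_val _ e.open_baseSet).inter
      (U'.isOpen.isOpenMap_subtype_val _ e'.open_baseSet)).inter l.open_baseSet⟩
  have hWU : W ≤ U := by rintro _ ⟨⟨⟨p, -, rfl⟩, -⟩, -⟩; exact p.2
  have hWU' : W ≤ U' := by rintro _ ⟨⟨-, ⟨p, -, rfl⟩⟩, -⟩; exact p.2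
  have he : ∀ p : W, incl hWU p ∈ e.baseSet := by
    rintro ⟨q, ⟨⟨⟨p, hp, rfl⟩, -⟩, -⟩⟩; exact hp
  have he' : ∀ p : W, incl hWU' p ∈ e'.baseSet := by
    rintro ⟨q, ⟨⟨-, ⟨p, hp, rfl⟩⟩, -⟩⟩; exact hp
  have hl : ∀ p : W, (p : M) ∈ l.baseSet := fun p => p.2.2
  have hxW : x ∈ W := ⟨⟨⟨⟨x, hx⟩, FiberBundle.mem_baseSet_trivializationAt ℂ O.τ.fiber _, rfl⟩,
    ⟨⟨x, hx'⟩, FiberBundle.mem_baseSet_trivializationAt ℂ O'.τ.fiber _, rfl⟩⟩,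
    FiberBundle.mem_baseSet_trivializationAt ℂ L.fiber x⟩
  have h₀ : ∀ p : W, O.frameSq e l (incl hWU p) ≠ 0 := fun p => O.frameSq_ne_zero e l (he p) (hl p)
  have h₀' : ∀ p : W, O'.frameSq e' l (incl hWU' p) ≠ 0 :=
    fun p => O'.frameSq_ne_zero e' l (he' p) (hl p)
  obtain ⟨V, hV, hxV, θ, hθ⟩ := exists_local_log (U := W)
    ⟨fun p => O.frameSq e l (incl hWU p) / O'.frameSq e' l (incl hWU' p),
      (O.continuous_frameSq e l (incl hWU).continuous he hl).div
        (O'.continuous_frameSq e' l (incl hWU').continuous he' hl) h₀'⟩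
    (fun p => div_ne_zero (h₀ p) (h₀' p)) ⟨x, hxW⟩
  -- Half of the logarithm: the factor `exp(πiθ)` is a continuous square root of the ratio of the
  -- two frame squares, exactly what compatibility with `ι` and `ι'` demands.
  let σ : LineBundle.Iso (O.τ.pullback (incl (hV.trans hWU))) (O'.τ.pullback (incl (hV.trans hWU'))) :=
    LineBundle.trivIso O.τ O'.τ e e' _ _ (fun p => he (incl hV p)) (fun p => he' (incl hV p))
      (fun p => Complex.exp (Real.pi * Complex.I * θ p)) (by fun_prop) fun p => Complex.exp_ne_zero _
  refine ⟨V, hV.trans hWU, hV.trans hWU', hxV, ⟨⟨σ, fun p t => ?_⟩⟩⟩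
  refine apply_congr_eq_of_apply_basis (O.ι (incl (hV.trans hWU) p))
    (O'.ι (incl (hV.trans hWU') p)) (σ.equiv p) (e.linearEquivAt ℂ _ (he (incl hV p)))
    (l.linearEquivAt ℂ (p : M) (hl (incl hV p)))
    (LineBundle.trivIso_symm_one _ _ _ _ _ _ _ _ _ _ _ p) ?_ t
  rw [← Complex.exp_add, ← two_mul, ← mul_assoc, ← mul_assoc, hθ]
  exact div_mul_cancel₀ _ (h₀' (incl hV p))

end SquareRoot

end SquareRoot

/-! ### Giraud data and uniqueness of the Giraud class -/

section Giraud

variable {M : Type u} [TopologicalSpace M]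

open Pseudofunctor.LocallyDiscreteOpToCat

/-- An explicit form of Giraud data of `√L`: square roots of `L` over the members of a cover,
isomorphisms between them on the double intersections, and the cocycle of signs of these. -/
structure SquareRoot.GiraudData (L : LineBundle.{u, v} M) (U : PointedCover M)
    (g : Z₂ (ZMod 2) U) where
  obj : ∀ x, SquareRoot L (U.set x)
  hom : ∀ x y, (SquareRoot.restrict (inf_le_right : U.inter₂ x y ≤ U.set y)).obj (obj y) ⟶
    (SquareRoot.restrict (inf_le_left : U.inter₂ x y ≤ U.set x)).obj (obj x)
  comp : ∀ x y z (p : U.inter₃ x y z) (w : (obj z).τ.fiber ⟨p, p.2.2⟩),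
    (hom x y).σ.equiv ⟨p, p.2.1⟩ ((hom y z).σ.equiv ⟨p, p.2.1.2, p.2.2⟩ w) =
      (sgn (g.1 x y z p) : ℂ) • (hom x z).σ.equiv ⟨p, p.2.1.1, p.2.2⟩ w

/-- The comparison isomorphisms inside `pullHom` are the identity on fibres, so the required
equality of automorphisms unfolds to `D.comp` evaluated at `σ_{xz}⁻¹ w`. -/
theorem isGiraudClass_sqrtBand_of {L : LineBundle.{u, v} M} {U : PointedCover M}
    {g : Z₂ (ZMod 2) U} (D : SquareRoot.GiraudData L U g) :
    IsGiraudClass (sqrtBand L) (cls (ZMod 2) U g) := by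
  refine ⟨U, D.obj, fun x y => (Groupoid.isoEquivHom
    (C := SquareRoot L (U.inter₂ x y)) _ _).symm (D.hom x y), g, rfl, fun x y z => ?_⟩
  refine SquareRoot.hom_ext fun p w => ?_
  refine (D.comp x y z p (((D.hom x z).σ.equiv ⟨p, p.2.1.1, p.2.2⟩).symm w)).trans ?_
  exact congrArg ((sgn (g.1 x y z p) : ℂ) • ·)
    (((D.hom x z).σ.equiv ⟨p, p.2.1.1, p.2.2⟩).apply_symm_apply w)

theorem exists_giraudData {L : LineBundle.{u, v} M} {γ : H2 M (ZMod 2)}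
    (h : IsGiraudClass (sqrtBand L) γ) :
    ∃ U g, Nonempty (SquareRoot.GiraudData L U g) ∧ cls (ZMod 2) U g = γ := by
  obtain ⟨U, O, σ, g, hg, hσ⟩ := h
  refine ⟨U, g, ⟨⟨O, fun x y => (σ x y).hom, fun x y z p w => ?_⟩⟩, hg⟩
  have h₁ := congrArg (fun f : SquareRoot.Hom _ _ => f.σ.equiv p
    ((SquareRoot.Hom.σ (σ x z).hom).equiv ⟨p, p.2.1.1, p.2.2⟩ w)) (hσ x y z)
  have h₂ : (SquareRoot.Hom.σ (σ x z).inv).equiv ⟨p, p.2.1.1, p.2.2⟩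
      ((SquareRoot.Hom.σ (σ x z).hom).equiv ⟨p, p.2.1.1, p.2.2⟩ w) = w :=
    congrArg (fun f : SquareRoot.Hom (U := U.inter₂ x z) _ _ =>
      f.σ.equiv ⟨p, p.2.1.1, p.2.2⟩ w) (σ x z).hom_inv_id
  refine Eq.trans ?_ h₁
  exact congrArg (fun w => (SquareRoot.Hom.σ (σ x y).hom).equiv ⟨p, p.2.1⟩
    ((SquareRoot.Hom.σ (σ y z).hom).equiv ⟨p, p.2.1.2, p.2.2⟩ w)) h₂.symm

/-- Giraud data of `√H` consist of Giraud data of the gerbe of the underlying complex line bundle,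
metrics and isometries. -/
theorem isGiraudClass_hermitianSqrtBand_of {H : HermitianLineBundle.{u, v} M} {U : PointedCover M}
    {g : Z₂ (ZMod 2) U} (obj : ∀ x, HermitianSquareRoot H (U.set x))
    (hom : ∀ x y,
      (HermitianSquareRoot.restrict (inf_le_right : U.inter₂ x y ≤ U.set y)).obj (obj y) ⟶
      (HermitianSquareRoot.restrict (inf_le_left : U.inter₂ x y ≤ U.set x)).obj (obj x))
    (comp : ∀ x y z (p : U.inter₃ x y z) (w : (obj z).τ.fiber ⟨p, p.2.2⟩),
      (hom x y).σ.equiv ⟨p, p.2.1⟩ ((hom y z).σ.equiv ⟨p, p.2.1.2, p.2.2⟩ w) =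
        (sgn (g.1 x y z p) : ℂ) • (hom x z).σ.equiv ⟨p, p.2.1.1, p.2.2⟩ w) :
    IsGiraudClass (hermitianSqrtBand H) (cls (ZMod 2) U g) := by
  refine ⟨U, obj, fun x y => (Groupoid.isoEquivHom
    (C := HermitianSquareRoot H (U.inter₂ x y)) _ _).symm (hom x y), g, rfl, fun x y z => ?_⟩
  refine HermitianSquareRoot.hom_ext fun p w => ?_
  refine (comp x y z p (((hom x z).σ.equiv ⟨p, p.2.1.1, p.2.2⟩).symm w)).trans ?_
  exact congrArg ((sgn (g.1 x y z p) : ℂ) • ·)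
    (((hom x z).σ.equiv ⟨p, p.2.1.1, p.2.2⟩).apply_symm_apply w)

/-- Forgetting metrics leaves the cocycle of signs unchanged. Uniqueness of the hermitian class
thereby reduces to the complex case, with no need for local isometries between hermitian roots. -/
theorem IsGiraudClass.of_hermitian {H : HermitianLineBundle.{u, v} M} {γ : H2 M (ZMod 2)}
    (h : IsGiraudClass (hermitianSqrtBand H) γ) :
    IsGiraudClass (sqrtBand H.toLineBundle) γ := by
  obtain ⟨U, O, σ, g, rfl, hσ⟩ := h
  refine isGiraudClass_sqrtBand_of ⟨fun x => HermitianSquareRoot.toSquareRoot (O x),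
    fun x y => HermitianSquareRoot.Hom.under (σ x y).hom, fun x y z p w => ?_⟩
  have h₁ := congrArg (fun f : HermitianSquareRoot.Hom _ _ => f.σ.equiv p
    ((HermitianSquareRoot.Hom.under (σ x z).hom).σ.equiv ⟨p, p.2.1.1, p.2.2⟩ w)) (hσ x y z)
  have h₂ : (HermitianSquareRoot.Hom.under (σ x z).inv).σ.equiv ⟨p, p.2.1.1, p.2.2⟩
      ((HermitianSquareRoot.Hom.under (σ x z).hom).σ.equiv ⟨p, p.2.1.1, p.2.2⟩ w) = w :=
    congrArg (fun f : HermitianSquareRoot.Hom (U := U.inter₂ x z) _ _ =>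
      f.σ.equiv ⟨p, p.2.1.1, p.2.2⟩ w)
      (σ x z).hom_inv_id
  refine Eq.trans ?_ h₁
  exact congrArg (fun w => (HermitianSquareRoot.Hom.under (σ x y).hom).σ.equiv ⟨p, p.2.1⟩
    ((HermitianSquareRoot.Hom.under (σ y z).hom).σ.equiv ⟨p, p.2.1.2, p.2.2⟩ w)) h₂.symm

namespace SquareRoot

variable {L : LineBundle.{u, v} M}

/-- Restriction of a morphism between restrictions. -/
def pull {U₁ U₂ V W : Opens M} {O₁ : SquareRoot L U₁} {O₂ : SquareRoot L U₂} {h₁ : V ≤ U₁}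
    {h₂ : V ≤ U₂} (φ : (restrict h₁).obj O₁ ⟶ (restrict h₂).obj O₂) (h : W ≤ V) (k₁ : W ≤ U₁)
    (k₂ : W ≤ U₂) : (restrict k₁).obj O₁ ⟶ (restrict k₂).obj O₂ :=
  (restrictComp h₁ h).hom.app O₁ ≫ (restrict h).map φ ≫ (restrictComp h₂ h).inv.app O₂

/-- Two parallel morphisms of square roots differ by a sign. -/
theorem exists_sgn_smul {U : Opens M} {O O' : SquareRoot L U} (f f' : O ⟶ O') :
    ∃ a : LocallyConstant U (ZMod 2), ∀ p w, f.σ.equiv p w = (sgn (a p) : ℂ) • f'.σ.equiv p w := by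
  obtain ⟨a, ha⟩ := O'.sgnHom_surjective (Groupoid.inv f' ≫ f)
  refine ⟨a, fun p w => ?_⟩
  rw [← sgnHom_apply, ha, comp_apply, ← comp_apply f', Groupoid.comp_inv, id_apply]

/-- Cocycles of signs of two choices of Giraud data have the same class. -/
theorem GiraudData.cls_eq {U U' : PointedCover M} {g : Z₂ (ZMod 2) U} {g' : Z₂ (ZMod 2) U'}
    (D : GiraudData L U g) (D' : GiraudData L U' g') :
    cls (ZMod 2) U g = cls (ZMod 2) U' g' := by
  -- The isomorphism `ρ x` is needed on a single neighbourhood of `x`, so the sets `V x` already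
  -- form a common refinement. On double intersections only a comparison of parallel morphisms
  -- remains.
  choose V h h' hx ρ using fun x => exists_local_hom (D.obj x) (D'.obj x) (U.mem x) (U'.mem x)
  replace ρ := fun x => (ρ x).some
  -- The sign `b x y` measures the failure of `ρ` to intertwine `D.hom x y` with `D'.hom x y`.
  have hb : ∀ x y, ∃ b : LocallyConstant (V x ⊓ V y : Opens M) (ZMod 2),
      ∀ (p : (V x ⊓ V y : Opens M)) (w : (D.obj y).τ.fiber ⟨p, h y p.2.2⟩),
      (ρ x).σ.equiv ⟨p, p.2.1⟩ ((D.hom x y).σ.equiv ⟨p, h x p.2.1, h y p.2.2⟩ w) =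
        (sgn (b p) : ℂ) • (D'.hom x y).σ.equiv ⟨p, h' x p.2.1, h' y p.2.2⟩
          ((ρ y).σ.equiv ⟨p, p.2.2⟩ w) := by
    intro x y
    exact exists_sgn_smul
      (pull (D.hom x y) (inf_le_inf (h x) (h y)) (inf_le_right.trans (h y))
        (inf_le_left.trans (h x)) ≫ pull (ρ x) inf_le_left _ (inf_le_left.trans (h' x)))
      (pull (ρ y) inf_le_right _ (inf_le_right.trans (h' y)) ≫
        pull (D'.hom x y) (inf_le_inf (h' x) (h' y)) _ _)
  choose b hb using hb
  refine cls_eq_cls (V := ⟨V, hx⟩) h h' g g' b fun x y z p => ?_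
  obtain ⟨e⟩ := (D.obj z).τ.exists_coord ⟨p, h z p.2.2⟩
  let w := e.symm 1
  have hw : w ≠ 0 := fun h => one_ne_zero (e.symm.map_eq_zero_iff.1 h)
  let s := (D'.hom x z).σ.equiv ⟨p, h' x p.2.1.1, h' z p.2.2⟩ ((ρ z).σ.equiv ⟨p, p.2.2⟩ w)
  have hs : s ≠ 0 := fun h => hw ((LinearEquiv.map_eq_zero_iff _).1
    ((LinearEquiv.map_eq_zero_iff _).1 h))
  -- The vector `ρ_x σ_{xy} σ_{yz} w` is computed in two ways. Here `σ_{xy} σ_{yz}` is contracted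
  -- first and `ρ` moved past `σ_{xz}`; in `h₂`, `ρ` is moved past both factors and the primed
  -- morphisms are contracted. As `s ≠ 0`, the signs agree.
  have h₁ : (ρ x).σ.equiv ⟨p, p.2.1.1⟩ ((D.hom x y).σ.equiv ⟨p, h x p.2.1.1, h y p.2.1.2⟩
      ((D.hom y z).σ.equiv ⟨p, h y p.2.1.2, h z p.2.2⟩ w)) =
      (sgn (g.1 x y z ⟨p, ⟨h x p.2.1.1, h y p.2.1.2⟩, h z p.2.2⟩ +
        b x z ⟨p, p.2.1.1, p.2.2⟩) : ℂ) • s := by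
    have := D.comp x y z ⟨p, ⟨h x p.2.1.1, h y p.2.1.2⟩, h z p.2.2⟩ w
    refine (congrArg ((ρ x).σ.equiv ⟨p, p.2.1.1⟩) this).trans ?_
    rw [sgn_add, Units.val_mul, mul_smul]
    refine (((ρ x).σ.equiv ⟨p, p.2.1.1⟩).map_smul _ _).trans ?_
    exact congrArg (_ • ·) (hb x z ⟨p, p.2.1.1, p.2.2⟩ w)
  have h₂ : (ρ x).σ.equiv ⟨p, p.2.1.1⟩ ((D.hom x y).σ.equiv ⟨p, h x p.2.1.1, h y p.2.1.2⟩
      ((D.hom y z).σ.equiv ⟨p, h y p.2.1.2, h z p.2.2⟩ w)) =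
      (sgn (b x y ⟨p, p.2.1⟩ + b y z ⟨p, p.2.1.2, p.2.2⟩ +
        g'.1 x y z ⟨p, ⟨h' x p.2.1.1, h' y p.2.1.2⟩, h' z p.2.2⟩) : ℂ) • s := by
    refine (hb x y ⟨p, p.2.1⟩ _).trans ?_
    rw [sgn_add, sgn_add, Units.val_mul, Units.val_mul, mul_smul, mul_smul]
    refine congrArg (_ • ·) ?_
    refine (congrArg ((D'.hom x y).σ.equiv ⟨p, h' x p.2.1.1, h' y p.2.1.2⟩)
      (hb y z ⟨p, p.2.1.2, p.2.2⟩ w)).trans ?_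
    refine (((D'.hom x y).σ.equiv _).map_smul _ _).trans ?_
    exact congrArg (_ • ·) (D'.comp x y z ⟨p, ⟨h' x p.2.1.1, h' y p.2.1.2⟩, h' z p.2.2⟩ _)
  have h₃ := sgn_injective (smul_left_injective ℂ hs (h₁.symm.trans h₂))
  linear_combination h₃

end SquareRoot

theorem IsGiraudClass.eq {L : LineBundle.{u, v} M} {γ γ' : H2 M (ZMod 2)}
    (h : IsGiraudClass (sqrtBand L) γ) (h' : IsGiraudClass (sqrtBand L) γ') : γ = γ' := by
  obtain ⟨U, g, ⟨D⟩, rfl⟩ := exists_giraudData h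
  obtain ⟨U', g', ⟨D'⟩, rfl⟩ := exists_giraudData h'
  exact D.cls_eq D'

end Giraud

/-! ### Existence and uniqueness of the Chern class -/

section Chern

variable {M : Type u} [TopologicalSpace M] {L : LineBundle.{u, v} M}

theorem exists_int_of_exp_eq {a b : ℂ} (h : Complex.exp (2 * Real.pi * Complex.I * a) =
    Complex.exp (2 * Real.pi * Complex.I * b)) : ∃ n : ℤ, a - b = n := by
  obtain ⟨n, hn⟩ := Complex.exp_eq_exp_iff_exists_int.1 h
  refine ⟨n, mul_left_cancel₀ Complex.two_pi_I_ne_zero ?_⟩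
  linear_combination hn

theorem LineBundle.triv_symm_one (e : Trivialization ℂ (π ℂ L.fiber)) {p : M}
    (hp : p ∈ e.baseSet) : (e ⟨p, e.symm p 1⟩).2 = 1 := by
  rw [e.apply_mk_symm hp]

theorem LineBundle.eq_smul_symm_one (e : Trivialization ℂ (π ℂ L.fiber)) [e.IsLinear ℂ] {p : M}
    (hp : p ∈ e.baseSet) (w : L.fiber p) : w = (e ⟨p, w⟩).2 • e.symm p 1 := by
  apply (e.linearEquivAt ℂ p hp).injective
  rw [map_smul]
  change (e ⟨p, w⟩).2 = (e ⟨p, w⟩).2 * (e ⟨p, e.symm p 1⟩).2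
  rw [triv_symm_one e hp, mul_one]

theorem LineBundle.triv_smul (e : Trivialization ℂ (π ℂ L.fiber)) [e.IsLinear ℂ] {p : M}
    (hp : p ∈ e.baseSet) (c : ℂ) (w : L.fiber p) : (e ⟨p, c • w⟩).2 = c * (e ⟨p, w⟩).2 :=
  (e.linear ℂ hp).map_smul c w

/-- Transition functions have local logarithms. -/
theorem LineBundle.exists_log_transition (e e' : Trivialization ℂ (π ℂ L.fiber)) [e.IsLinear ℂ]
    [e'.IsLinear ℂ] {x : M} (hx : x ∈ e.baseSet) (hx' : x ∈ e'.baseSet) :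
    ∃ V : Opens M, x ∈ V ∧ (V : Set M) ⊆ e.baseSet ∧ (V : Set M) ⊆ e'.baseSet ∧ ∃ θ : C(V, ℂ),
      ∀ (p : V) (w : L.fiber p),
        (e ⟨p, w⟩).2 = Complex.exp (2 * Real.pi * Complex.I * θ p) * (e' ⟨p, w⟩).2 := by
  let W : Opens M := ⟨e.baseSet ∩ e'.baseSet, e.open_baseSet.inter e'.open_baseSet⟩
  -- The transition function is the `e`-coordinate of the unit frame of `e'`; evaluated at the unit
  -- frame of `e`, this identity also shows that it has no zeros.
  have key : ∀ p ∈ W, ∀ w : L.fiber p,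
      (e ⟨p, w⟩).2 = (e ⟨p, e'.symm p 1⟩).2 * (e' ⟨p, w⟩).2 := by
    intro p hp w
    conv_lhs => rw [eq_smul_symm_one e' hp.2 w]
    rw [triv_smul e hp.1, mul_comm]
  obtain ⟨V, hV, hxV, θ, hθ⟩ := exists_local_log (U := W)
    ⟨fun p => (e ⟨p, e'.symm p 1⟩).2, L.continuous_triv e
      (L.continuous_triv_symm e' continuous_subtype_val continuous_const fun p => p.2.2)
      fun p => p.2.1⟩
    (fun p h => by
      have := key p p.2 (e.symm p 1)
      rw [triv_symm_one e p.2.1] at this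
      exact one_ne_zero (this.trans ((congrArg (· * _) h).trans (zero_mul _))))
    ⟨x, hx, hx'⟩
  exact ⟨V, hxV, fun p hp => (hV hp).1, fun p hp => (hV hp).2, θ, fun p w => by
    rw [hθ]; exact key p (hV p.2) w⟩

/-- Chern data formed from given local trivializations. -/
theorem exists_chernData [T2Space M] [ParacompactSpace M]
    (e : M → Trivialization ℂ (π ℂ L.fiber)) (he : ∀ x, (e x).IsLinear ℂ)
    (hx : ∀ x, x ∈ (e x).baseSet) :
    ∃ (U : PointedCover M) (t : M → M) (θ : ∀ x y, C(U.inter₂ x y, ℂ)) (n : Z₂ ℤ U),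
      (∀ x, (U.set x : Set M) ⊆ (e (t x)).baseSet) ∧
      (∀ x y (p : U.inter₂ x y) (w : L.fiber p), (e (t x) ⟨p, w⟩).2 =
        Complex.exp (2 * Real.pi * Complex.I * θ x y p) * (e (t y) ⟨p, w⟩).2) ∧
      (∀ x y z (p : U.inter₃ x y z), ((n.1 x y z p : ℤ) : ℂ) =
        θ x y ⟨p, p.2.1⟩ + θ y z ⟨p, p.2.1.2, p.2.2⟩ - θ x z ⟨p, p.2.1.1, p.2.2⟩) := by
  -- The hereditary local property is the existence of a logarithm of the transition function. The
  -- refinement makes logarithms available on entire double intersections.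
  obtain ⟨U, t, hU, hP⟩ := PointedCover.exists_refinement
    ⟨fun x => ⟨(e x).baseSet, (e x).open_baseSet⟩, hx⟩
    (fun x y V => ∃ θ : C(V, ℂ), ∀ (p : V) (w : L.fiber p),
        (e x ⟨p, w⟩).2 = Complex.exp (2 * Real.pi * Complex.I * θ p) * (e y ⟨p, w⟩).2)
    (fun x y V V' h ⟨θ, hθ⟩ => ⟨θ.comp (incl h), fun p w => hθ (incl h p) w⟩)
    (fun x y => ⟨⟨fun _ => 0, continuous_const⟩, fun p => p.2.elim⟩)
    (fun x y p hp => by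
      have := he x
      have := he y
      obtain ⟨V, hV, -, -, h⟩ := LineBundle.exists_log_transition (e x) (e y) hp.1 hp.2
      exact ⟨V, hV, h⟩)
  choose θ hθ using hP
  have hn : ∀ x y z, ∃ n : LocallyConstant (U.inter₃ x y z) ℤ, ∀ p : U.inter₃ x y z, (n p : ℂ) =
      θ x y ⟨p, p.2.1⟩ + θ y z ⟨p, p.2.1.2, p.2.2⟩ - θ x z ⟨p, p.2.1.1, p.2.2⟩ := by
    intro x y z
    refine exists_locallyConstant_int ⟨fun p : U.inter₃ x y z => θ x y ⟨p, p.2.1⟩ + θ y z ⟨p, p.2.1.2, p.2.2⟩ -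
      θ x z ⟨p, p.2.1.1, p.2.2⟩, by fun_prop⟩ fun p => exists_int_of_exp_eq ?_
    -- Evaluating the transition relations at the unit frame of the third trivialization turns them
    -- into the multiplicative cocycle identity of the exponentials.
    have h₁ := LineBundle.triv_symm_one (e (t z)) (hU z p.2.2)
    have h₂ := hθ x y ⟨p, p.2.1⟩ ((e (t z)).symm p 1)
    rw [hθ y z ⟨p, p.2.1.2, p.2.2⟩, hθ x z ⟨p, p.2.1.1, p.2.2⟩, h₁, mul_one, mul_one,
      ← Complex.exp_add, ← mul_add] at h₂
    exact h₂.symm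
  choose n hn using hn
  refine ⟨U, t, θ, ⟨n, mem_Z₂_iff.2 fun x y z w p => ?_⟩, hU, hθ, hn⟩
  -- Over `ℂ` the cochain `n` is the coboundary of `θ`, so it is a cocycle there, and `ℤ` embeds in
  -- `ℂ`.
  have : ∀ a : ℤ, (a : ℂ) = 0 → a = 0 := fun a => Int.cast_eq_zero.1
  apply this
  push_cast
  rw [hn, hn, hn, hn]
  ring

/-- Near `x` write `ε_x = exp(2πiφ_x) ε'_x`. Then `b_{xy} = θ_{xy} + φ_y - φ_x - θ'_{xy}` is
integral, since its terms give two expressions of `ε_x` through `ε'_y`. In the coboundary of `b` the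
`φ` cancel, leaving `n - n'`. -/
theorem IsChernClass.eq {c c' : H2 M ℤ} (h : IsChernClass L c) (h' : IsChernClass L c') :
    c = c' := by
  obtain ⟨U, ε, θ, n, hε, hθ, hn, rfl⟩ := h
  obtain ⟨U', ε', θ', n', hε', hθ', hn', rfl⟩ := h'
  have hloc : ∀ x, ∃ (V : Opens M), V ≤ U.set x ∧ V ≤ U'.set x ∧ x ∈ V ∧ ∃ φ : C(V, ℂ),
      ∀ (p : V) (w : L.fiber p),
        (ε x ⟨p, w⟩).2 = Complex.exp (2 * Real.pi * Complex.I * φ p) * (ε' x ⟨p, w⟩).2 := by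
    intro x
    have := (hε x).1
    have := (hε' x).1
    obtain ⟨V, hV, -, -, φ, hφ⟩ := LineBundle.exists_log_transition (ε x) (ε' x)
      ((hε x).2 (U.mem x)) ((hε' x).2 (U'.mem x))
    exact ⟨V ⊓ (U.set x ⊓ U'.set x), inf_le_right.trans inf_le_left,
      inf_le_right.trans inf_le_right, ⟨hV, U.mem x, U'.mem x⟩, φ.comp (incl inf_le_left),
      fun p w => hφ (incl inf_le_left p) w⟩
  choose V hV hV' hx φ hφ using hloc
  have hb : ∀ x y, ∃ b : LocallyConstant (V x ⊓ V y : Opens M) ℤ, ∀ p : (V x ⊓ V y : Opens M),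
      (b p : ℂ) = θ x y ⟨p, hV x p.2.1, hV y p.2.2⟩ + φ y ⟨p, p.2.2⟩ -
        (φ x ⟨p, p.2.1⟩ + θ' x y ⟨p, hV' x p.2.1, hV' y p.2.2⟩) := by
    intro x y
    refine exists_locallyConstant_int ⟨fun p : (V x ⊓ V y : Opens M) =>
        θ x y ⟨p, hV x p.2.1, hV y p.2.2⟩ + φ y ⟨p, p.2.2⟩ -
        (φ x ⟨p, p.2.1⟩ + θ' x y ⟨p, hV' x p.2.1, hV' y p.2.2⟩), by fun_prop⟩
      fun p => exists_int_of_exp_eq ?_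
    have h₁ := LineBundle.triv_symm_one (ε' y) ((hε' y).2 (hV' y p.2.2))
    have h₂ := hφ x ⟨p, p.2.1⟩ ((ε' y).symm p 1)
    rw [hθ x y ⟨p, hV x p.2.1, hV y p.2.2⟩, hφ y ⟨p, p.2.2⟩,
      hθ' x y ⟨p, hV' x p.2.1, hV' y p.2.2⟩, h₁, mul_one, mul_one,
      ← Complex.exp_add, ← Complex.exp_add, ← mul_add, ← mul_add] at h₂
    exact h₂
  choose b hb using hb
  refine cls_eq_cls (V := ⟨V, hx⟩) hV hV' n n' b fun x y z p => ?_
  apply Int.cast_injective (α := ℂ)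
  push_cast
  rw [hn, hn', hb, hb, hb]
  ring

theorem IsHermitianChernClass.isChernClass {H : HermitianLineBundle.{u, v} M} {c : H2 M ℤ}
    (h : IsHermitianChernClass H c) : IsChernClass H.toLineBundle c := by
  obtain ⟨U, ε, θ, n, hε, -, hθ, hn, rfl⟩ := h
  refine ⟨U, ε, fun x y => ⟨fun p => (θ x y p : ℂ), by fun_prop⟩, n, hε, hθ, fun x y z p => ?_, rfl⟩
  have := congrArg (fun r : ℝ => (r : ℂ)) (hn x y z p)
  push_cast at this
  exact this

theorem exists_isChernClass [T2Space M] [ParacompactSpace M] (L : LineBundle.{u, v} M) :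
    ∃ c, IsChernClass L c := by
  obtain ⟨U, t, θ, n, hU, hθ, hn⟩ := exists_chernData (L := L)
    (fun x => trivializationAt ℂ L.fiber x) (fun x => inferInstance)
    (fun x => FiberBundle.mem_baseSet_trivializationAt ℂ L.fiber x)
  exact ⟨_, U, fun x => trivializationAt ℂ L.fiber (t x), θ, n,
    fun x => ⟨inferInstance, hU x⟩, hθ, hn, rfl⟩

/-- The product of a trivialization and a function without zeros. -/
def LineBundle.smulTriv (e : Trivialization ℂ (π ℂ L.fiber)) (c : M → ℂ)
    (hc : ContinuousOn c e.baseSet) (h₀ : ∀ p ∈ e.baseSet, c p ≠ 0) :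
    Trivialization ℂ (π ℂ L.fiber) where
  toFun z := (z.1, c z.1 * (e z).2)
  invFun z := ⟨z.1, e.symm z.1 ((c z.1)⁻¹ * z.2)⟩
  source := e.source
  target := e.baseSet ×ˢ Set.univ
  map_source' z hz := ⟨e.mem_source.1 hz, trivial⟩
  map_target' z hz := e.mem_source.2 hz.1
  left_inv' z hz := by
    have hb := e.mem_source.1 hz
    simp only [inv_mul_cancel_left₀ (h₀ _ hb)]
    rw [e.symm_apply_apply_mk hb]
  right_inv' z hz := by
    ext
    · rfl
    · change c z.1 * (e ⟨z.1, e.symm z.1 ((c z.1)⁻¹ * z.2)⟩).2 = z.2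
      rw [e.apply_mk_symm hz.1, mul_inv_cancel_left₀ (h₀ _ hz.1)]
  open_source := e.open_source
  open_target := e.open_baseSet.prod isOpen_univ
  continuousOn_toFun := by
    have hπ : ContinuousOn (fun z : L.Total => z.1) e.source :=
      (FiberBundle.continuous_proj ℂ L.fiber).continuousOn
    exact hπ.prodMk ((hc.comp hπ fun z hz => e.mem_source.1 hz).mul
      (continuous_snd.comp_continuousOn e.continuousOn))
  continuousOn_invFun := by
    refine e.continuousOn_symm.comp (f := fun z : M × ℂ => (z.1, (c z.1)⁻¹ * z.2))
      (continuous_fst.continuousOn.prodMk (ContinuousOn.mul ?_ continuous_snd.continuousOn))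
      fun z hz => ⟨hz.1, trivial⟩
    exact (hc.inv₀ h₀).comp continuous_fst.continuousOn fun z hz => hz.1
  baseSet := e.baseSet
  open_baseSet := e.open_baseSet
  source_eq := e.source_eq
  target_eq := rfl
  proj_toFun z hz := rfl

theorem LineBundle.smulTriv_apply (e : Trivialization ℂ (π ℂ L.fiber)) (c : M → ℂ)
    (hc : ContinuousOn c e.baseSet) (h₀ : ∀ p ∈ e.baseSet, c p ≠ 0) (z : L.Total) :
    (smulTriv e c hc h₀ z).2 = c z.1 * (e z).2 := rfl

theorem LineBundle.smulTriv_isLinear (e : Trivialization ℂ (π ℂ L.fiber)) [e.IsLinear ℂ]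
    (c : M → ℂ) (hc : ContinuousOn c e.baseSet) (h₀ : ∀ p ∈ e.baseSet, c p ≠ 0) :
    (smulTriv e c hc h₀).IsLinear ℂ where
  linear p hp :=
    { map_add := fun w w' => by
        rw [smulTriv_apply, smulTriv_apply, smulTriv_apply, ← mul_add]
        exact congrArg (c p * ·) ((e.linear ℂ hp).map_add w w')
      map_smul := fun r w => by
        rw [smulTriv_apply, smulTriv_apply, smul_eq_mul, mul_left_comm]
        exact congrArg (c p * ·) ((e.linear ℂ hp).map_smul r w) }

theorem coreInner_smul_smul {F : Type*} [AddCommGroup F] [Module ℂ F]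
    (c : InnerProductSpace.Core ℂ F) (r r' : ℂ) (v v' : F) :
    c.inner (r • v) (r' • v') = starRingEnd ℂ r * r' * c.inner v v' := by
  rw [c.smul_left, ← c.conj_inner_symm, c.smul_left, map_mul, c.conj_inner_symm]
  simp [mul_assoc]

namespace HermitianLineBundle

/-- Hermitian line bundles have isometric local trivializations. -/
theorem exists_isometric_triv (H : HermitianLineBundle.{u, v} M) (x : M) :
    ∃ e : Trivialization ℂ (π ℂ H.fiber), e.IsLinear ℂ ∧ x ∈ e.baseSet ∧
      ∀ p ∈ e.baseSet, ∀ w w' : H.fiber p,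
        (H.metric p).inner w w' = inner ℂ (e ⟨p, w⟩).2 (e ⟨p, w'⟩).2 := by
  let e := trivializationAt ℂ H.fiber x
  -- The squared length of the unit frame of `e`. Multiplying `e` by its positive square root gives
  -- an isometric trivialization.
  let N : M → ℂ := fun p => (H.metric p).inner (e.symm p 1) (e.symm p 1)
  have hN : ContinuousOn N e.baseSet := by
    rw [continuousOn_iff_continuous_domRestrict]
    have hs := H.toLineBundle.continuous_triv_symm e (continuous_subtype_val (p := (· ∈ e.baseSet)))
      (continuous_const (y := (1 : ℂ))) fun p => p.2
    exact H.continuous_metric.comp (H.toLineBundle.continuous_mk₂ hs hs)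
  have hre : ∀ p, N p = ((N p).re : ℂ) := fun p =>
    (Complex.conj_eq_iff_re.1 ((H.metric p).conj_inner_symm _ _)).symm
  have hpos : ∀ p ∈ e.baseSet, 0 < (N p).re := by
    intro p hp
    refine lt_of_le_of_ne ((H.metric p).re_inner_nonneg _) fun h => ?_
    have h₁ : N p = 0 := by rw [hre, ← h, Complex.ofReal_zero]
    have h₂ := LineBundle.triv_symm_one e hp
    rw [(H.metric p).definite _ h₁] at h₂
    exact zero_ne_one (((e.linear ℂ hp).map_zero).symm.trans h₂)
  have hc : ContinuousOn (fun p => (Real.sqrt (N p).re : ℂ)) e.baseSet :=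
    Complex.continuous_ofReal.comp_continuousOn
      (Real.continuous_sqrt.comp_continuousOn (Complex.continuous_re.comp_continuousOn hN))
  have h₀ : ∀ p ∈ e.baseSet, (Real.sqrt (N p).re : ℂ) ≠ 0 := fun p hp =>
    Complex.ofReal_ne_zero.2 (Real.sqrt_pos.2 (hpos p hp)).ne'
  refine ⟨LineBundle.smulTriv e _ hc h₀, LineBundle.smulTriv_isLinear e _ hc h₀,
    FiberBundle.mem_baseSet_trivializationAt ℂ H.fiber x, fun p hp w w' => ?_⟩
  have hp : p ∈ e.baseSet := hp
  rw [LineBundle.smulTriv_apply, LineBundle.smulTriv_apply]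
  conv_lhs => rw [LineBundle.eq_smul_symm_one e hp w, LineBundle.eq_smul_symm_one e hp w',
    coreInner_smul_smul]
  change _ * N p = _
  have hsq : (Real.sqrt (N p).re : ℂ) * (Real.sqrt (N p).re : ℂ) = N p := by
    rw [← Complex.ofReal_mul, Real.mul_self_sqrt (hpos p hp).le, ← hre]
  rw [RCLike.inner_apply, map_mul, Complex.conj_ofReal]
  linear_combination -starRingEnd ℂ (e ⟨p, w⟩).2 * (e ⟨p, w'⟩).2 * hsq

theorem exists_isHermitianChernClass [T2Space M] [ParacompactSpace M]
    (H : HermitianLineBundle.{u, v} M) : ∃ c, IsHermitianChernClass H c := by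
  choose e he hx hi using H.exists_isometric_triv
  obtain ⟨U, t, θ, n, hU, hθ, hn⟩ := exists_chernData (L := H.toLineBundle) e he hx
  -- No new choice of logarithms is needed: isometric transition functions have modulus one. This
  -- gives `exp(-4π Im θ) = 1`, and comparing real parts of the exponents yields `Im θ = 0`.
  have hreal : ∀ x y (p : U.inter₂ x y), θ x y p = ((θ x y p).re : ℂ) := by
    intro x y p
    have h₁ := LineBundle.triv_symm_one (e (t y)) (hU y p.2.2)
    have h₂ := hθ x y p ((e (t y)).symm p 1)
    have h₃ := (hi (t x) p (hU x p.2.1) ((e (t y)).symm p 1) ((e (t y)).symm p 1)).symm.trans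
      (hi (t y) p (hU y p.2.2) _ _)
    rw [h₂, h₁, mul_one, RCLike.inner_apply, RCLike.inner_apply, map_one, one_mul,
      ← Complex.exp_conj, ← Complex.exp_add, Complex.exp_eq_one_iff] at h₃
    obtain ⟨m, hm⟩ := h₃
    have h₄ := congrArg Complex.re hm
    have him : (θ x y p).im = 0 := by simpa using h₄
    exact Complex.ext rfl (by simp [him])
  refine ⟨_, U, fun x => e (t x), fun x y => ⟨fun p => (θ x y p).re, by fun_prop⟩, n,
    fun x => ⟨he _, hU x⟩, fun x p w w' => hi (t x) p (hU x p.2) w w', fun x y p w => ?_,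
    fun x y z p => ?_, rfl⟩
  · refine (hθ x y p w).trans ?_
    rw [hreal x y p]
    rfl
  · have := congrArg Complex.re (hn x y z p)
    simpa using this

end HermitianLineBundle

end Chern

/-! ### Square roots from trivializations and the reduction modulo two -/

section Trivialized

variable {M : Type u} [TopologicalSpace M]

/-- The minus sign is harmless for the parity of `n`; it matches the factors `exp(-πiθ)` used as
gluing morphisms. -/
theorem sgn_intCast (n : ℤ) : (sgn (n : ZMod 2) : ℂ) = Complex.exp (-(Real.pi * Complex.I * n)) := by
  obtain ⟨k, rfl | rfl⟩ := n.even_or_odd'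
  · have h : ((2 * k : ℤ) : ZMod 2) = 0 := by
      rw [ZMod.intCast_zmod_eq_zero_iff_dvd]; exact dvd_mul_right _ _
    rw [h, sgn_zero, ← Complex.exp_int_mul_two_pi_mul_I (-k)]
    congr 1
    push_cast
    ring
  · have h : ((2 * k + 1 : ℤ) : ZMod 2) = 1 := by
      rw [Int.cast_add, Int.cast_one, add_eq_right, ZMod.intCast_zmod_eq_zero_iff_dvd]
      exact dvd_mul_right _ _
    have h' : (-(Real.pi * Complex.I * (2 * k + 1 : ℤ)) : ℂ) =
        ((-k - 1 : ℤ) : ℂ) * (2 * Real.pi * Complex.I) + Real.pi * Complex.I := by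
      push_cast
      ring
    rw [h, sgn_one, h', Complex.exp_add, Complex.exp_int_mul_two_pi_mul_I, one_mul,
      Complex.exp_pi_mul_I]

/-- The inclusion of an open set. -/
def val (U : Opens M) : C(U, M) := ⟨Subtype.val, continuous_subtype_val⟩

namespace SquareRoot

variable {L : LineBundle.{u, v} M}

/-- The square root `L|_U ⊗ L|_U → L|_U`, `v ⊗ w ↦ e(v) w`, given by a trivialization `e`. -/
def ofTriv (U : Opens M) (e : Trivialization ℂ (π ℂ L.fiber)) (he : e.IsLinear ℂ)
    (hU : (U : Set M) ⊆ e.baseSet) : SquareRoot L U where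
  τ := L.pullback (val U)
  ι p := (TensorProduct.congr (e.linearEquivAt ℂ (p : M) (hU p.2))
    (LinearEquiv.refl ℂ (L.fiber p))).trans (TensorProduct.lid ℂ (L.fiber p))
  continuous_ι := by
    have h := (FiberBundle.Prod.isInducing_diag ℂ (L.pullback (val U)).fiber ℂ
      (L.pullback (val U)).fiber).continuous
    have h₁ := (L.continuous_lift (val U)).comp (continuous_fst.comp h)
    have h₂ := (L.continuous_lift (val U)).comp (continuous_snd.comp h)
    exact L.continuous_smul (L.continuous_triv e h₁ fun q => hU q.1.2) h₂

/-- Multiplication by a function, between the square roots given by two trivializations. -/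
def ofTrivHom {U U' V : Opens M} {e e' : Trivialization ℂ (π ℂ L.fiber)} (he : e.IsLinear ℂ)
    (he' : e'.IsLinear ℂ) (hU : (U : Set M) ⊆ e.baseSet) (hU' : (U' : Set M) ⊆ e'.baseSet)
    (h : V ≤ U) (h' : V ≤ U') (c : V → ℂ) (hc : Continuous c) (h₀ : ∀ p, c p ≠ 0)
    (hec : ∀ (p : V) (w : L.fiber p), c p * c p * (e' ⟨p, w⟩).2 = (e ⟨p, w⟩).2) :
    (restrict h).obj (ofTriv U e he hU) ⟶ (restrict h').obj (ofTriv U' e' he' hU') where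
  σ :=
    { equiv := fun p => (LinearEquiv.smulOfUnit (Units.mk0 (c p) (h₀ p)) :
        L.fiber p ≃ₗ[ℂ] L.fiber p)
      continuous_equiv := by
        have hπ := FiberBundle.continuous_proj ℂ
          ((L.pullback (val U)).pullback (incl h)).fiber
        refine LineBundle.continuous_to_pullback _ _ hπ ?_
        refine LineBundle.continuous_to_pullback _ _ ((incl h').continuous.comp hπ) ?_
        exact L.continuous_smul (hc.comp hπ)
          ((L.continuous_lift (val U)).comp ((L.pullback (val U)).continuous_lift (incl h)))
      continuous_symm := by
        have hπ := FiberBundle.continuous_proj ℂ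
          ((L.pullback (val U')).pullback (incl h')).fiber
        refine LineBundle.continuous_to_pullback _ _ hπ ?_
        refine LineBundle.continuous_to_pullback _ _ ((incl h).continuous.comp hπ) ?_
        exact L.continuous_smul ((hc.inv₀ h₀).comp hπ)
          ((L.continuous_lift (val U')).comp ((L.pullback (val U')).continuous_lift (incl h'))) }
  comm p t := by
    -- Both tensor factors contribute a factor `c p`, one through `e'` and one directly, so `c²`
    -- appears and `hec` absorbs it.
    have key : ∀ v w : L.fiber p, (e' ⟨p, c p • v⟩).2 • c p • w = (e ⟨p, v⟩).2 • w := by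
      intro v w
      rw [LineBundle.triv_smul e' (hU' (h' p.2)), smul_smul, ← hec, mul_right_comm]
    induction t with
    | zero => exact (LinearEquiv.map_zero _).trans (LinearEquiv.map_zero _).symm
    | add s t hs ht => rw [map_add, map_add, map_add, hs, ht]
    | tmul v w => exact key v w

end SquareRoot

/-- Chern data determine Giraud data whose class is the reduction modulo two. -/
theorem IsChernClass.isGiraudClass_mod2 {L : LineBundle.{u, v} M} {c : H2 M ℤ}
    (h : IsChernClass L c) : IsGiraudClass (sqrtBand L) (mod2 M c) := by
  obtain ⟨U, ε, θ, n, hε, hθ, hn, rfl⟩ := h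
  rw [mod2_cls]
  -- The morphism goes from the root of `ε_y` to that of `ε_x`, so the square of its factor must
  -- carry `ε_x` to `ε_y`; hence the exponent `-πiθ_{xy}`.
  refine isGiraudClass_sqrtBand_of ⟨fun x => SquareRoot.ofTriv (U.set x) (ε x) (hε x).1 (hε x).2,
    fun x y => SquareRoot.ofTrivHom (hε y).1 (hε x).1 (hε y).2 (hε x).2 inf_le_right inf_le_left
      (fun p => Complex.exp (-(Real.pi * Complex.I * θ x y p))) (by fun_prop)
      (fun p => Complex.exp_ne_zero _) fun p w => ?_, fun x y z p w => ?_⟩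
  · rw [hθ x y p w, ← mul_assoc, ← Complex.exp_add, ← Complex.exp_add]
    ring_nf
    simp
  · change (_ : ℂ) • (_ : ℂ) • (w : L.fiber p) = (sgn ((n.1 x y z p : ℤ) : ZMod 2) : ℂ) • (_ : ℂ) • _
    rw [smul_smul, smul_smul]
    refine congrArg (· • (w : L.fiber p)) ?_
    refine (Complex.exp_add _ _).symm.trans (Eq.trans ?_ (congrArg (· * _) (sgn_intCast _).symm))
    rw [hn]
    refine Eq.trans ?_ (Complex.exp_add _ _)
    congr 1
    ring

namespace HermitianSquareRoot

variable {H : HermitianLineBundle.{u, v} M}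

/-- The hermitian square root given by an isometric trivialization. -/
def ofTriv (U : Opens M) (e : Trivialization ℂ (π ℂ H.fiber)) (he : e.IsLinear ℂ)
    (hU : (U : Set M) ⊆ e.baseSet) (hi : ∀ (p : U) (w w' : H.fiber p),
      (H.metric p).inner w w' = inner ℂ (e ⟨p, w⟩).2 (e ⟨p, w'⟩).2) :
    HermitianSquareRoot H U where
  toSquareRoot := SquareRoot.ofTriv U e he hU
  metric p := H.metric p
  continuous_metric := (H.pullback (val U)).continuous_metric
  isometry_ι p v w v' w' := by
    -- The form on the images `e(v) w` and `e(v') w'` is `conj(e(v)) e(v') ⟨w, w'⟩`, and the first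
    -- two factors give `⟨v, v'⟩` because `e` is isometric.
    refine (coreInner_smul_smul (H.metric p) _ _ w w').trans
      (congrArg (· * (H.metric p).inner w w') ((mul_comm _ _).trans (hi p v v').symm))

end HermitianSquareRoot

/-- The complex construction applies; as `θ` is real, `exp(-πiθ)` has modulus one and the gluing
morphisms are isometric. -/
theorem IsHermitianChernClass.isGiraudClass_mod2 {H : HermitianLineBundle.{u, v} M} {c : H2 M ℤ}
    (h : IsHermitianChernClass H c) : IsGiraudClass (hermitianSqrtBand H) (mod2 M c) := by
  obtain ⟨U, ε, θ, n, hε, hi, hθ, hn, rfl⟩ := h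
  rw [mod2_cls]
  refine isGiraudClass_hermitianSqrtBand_of
    (fun x => HermitianSquareRoot.ofTriv (U.set x) (ε x) (hε x).1 (hε x).2 (hi x))
    (fun x y => ⟨SquareRoot.ofTrivHom (hε y).1 (hε x).1 (hε y).2 (hε x).2 inf_le_right inf_le_left
      (fun p => Complex.exp (-(Real.pi * Complex.I * θ x y p))) (by fun_prop)
      (fun p => Complex.exp_ne_zero _) fun p w => ?_, fun p v w => ?_⟩) fun x y z p w => ?_
  · rw [hθ x y p w, ← mul_assoc, ← Complex.exp_add, ← Complex.exp_add]
    ring_nf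
    simp
  · refine (coreInner_smul_smul (H.metric p) _ _ v w).trans ?_
    refine (congrArg (· * (H.metric p).inner v w) ?_).trans (one_mul _)
    change starRingEnd ℂ (Complex.exp (-(Real.pi * Complex.I * θ x y p))) *
      Complex.exp (-(Real.pi * Complex.I * θ x y p)) = 1
    rw [← Complex.exp_conj, ← Complex.exp_add]
    simp
  · change (_ : ℂ) • (_ : ℂ) • (w : H.fiber p) = (sgn ((n.1 x y z p : ℤ) : ZMod 2) : ℂ) • (_ : ℂ) • _
    rw [smul_smul, smul_smul]
    refine congrArg (· • (w : H.fiber p)) ?_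
    refine (Complex.exp_add _ _).symm.trans (Eq.trans ?_ (congrArg (· * _) (sgn_intCast _).symm))
    rw [← Complex.ofReal_intCast, hn]
    push_cast
    refine Eq.trans ?_ (Complex.exp_add _ _)
    congr 1
    ring

end Trivialized

end SqrtGerbe

end

theorem proposition2p1 {M : Type u} [TopologicalSpace M] [T2Space M] [ParacompactSpace M] :
    (∀ L : SqrtGerbe.LineBundle.{u, v} M,
      (∃! γ : SqrtGerbe.H2 M (ZMod 2), SqrtGerbe.IsGiraudClass (SqrtGerbe.sqrtBand L) γ) ∧
      (∃! c : SqrtGerbe.H2 M ℤ, SqrtGerbe.IsChernClass L c) ∧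
      ∀ (γ : SqrtGerbe.H2 M (ZMod 2)) (c : SqrtGerbe.H2 M ℤ),
        SqrtGerbe.IsGiraudClass (SqrtGerbe.sqrtBand L) γ → SqrtGerbe.IsChernClass L c →
          γ = SqrtGerbe.mod2 M c) ∧
    (∀ H : SqrtGerbe.HermitianLineBundle.{u, v} M,
      (∃! γ : SqrtGerbe.H2 M (ZMod 2), SqrtGerbe.IsGiraudClass (SqrtGerbe.hermitianSqrtBand H) γ) ∧
      (∃! c : SqrtGerbe.H2 M ℤ, SqrtGerbe.IsHermitianChernClass H c) ∧
      ∀ (γ : SqrtGerbe.H2 M (ZMod 2)) (c : SqrtGerbe.H2 M ℤ),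
        SqrtGerbe.IsGiraudClass (SqrtGerbe.hermitianSqrtBand H) γ →
          SqrtGerbe.IsHermitianChernClass H c → γ = SqrtGerbe.mod2 M c) := by
  refine ⟨fun L => ?_, fun H => ?_⟩
  · obtain ⟨c, hc⟩ := SqrtGerbe.exists_isChernClass L
    -- The Giraud class exists as the reduction of a Chern class, and the comparison of the two
    -- classes is then an instance of its uniqueness.
    exact ⟨⟨_, hc.isGiraudClass_mod2, fun _ hγ => hγ.eq hc.isGiraudClass_mod2⟩,
      ⟨c, hc, fun _ hc' => hc'.eq hc⟩, fun _ _ hγ hc' => hγ.eq hc'.isGiraudClass_mod2⟩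
  · obtain ⟨c, hc⟩ := H.exists_isHermitianChernClass
    exact ⟨⟨_, hc.isGiraudClass_mod2, fun _ hγ =>
        hγ.of_hermitian.eq hc.isGiraudClass_mod2.of_hermitian⟩,
      ⟨c, hc, fun _ hc' => hc'.isChernClass.eq hc.isChernClass⟩,
      fun _ _ hγ hc' => hγ.of_hermitian.eq hc'.isGiraudClass_mod2.of_hermitian⟩
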